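/- Setting. Let $d\ge 1$. $\mathcal G(\mathbb R^d)=\mathcal E_M(\mathbb R^d)/\mathcal N(\mathbb R^d)$ is the special Colombeau algebra: nets $(u_\varepsilon)_{\varepsilon\in(0,1]}$ of smooth functions $\mathbb R^d\to\mathbb C$ all of whose derivatives are $O(\varepsilon^{-N})$ for some $N$ uniformly on each compact set, modulo the nets all of whose derivatives are $O(\varepsilon^{m})$ for every $m$ uniformly on each compact set; $\widetilde{\mathbb C}$ denotes the ring of generalized numbers (moderate nets of complex numbers modulo negligible nets). Let $\rho$ be a Schwartz function on $\mathbb R^d$ with $\int\rho=1$ and $\int x^\beta\rho(x)\,dx=0$ for all multi-indices $\beta\neq0$, put $\rho_\varepsilon(x)=\varepsilon^{-d}\rho(x/\varepsilon)$, let $(\chi_j)_{j\in\mathbb N}$ be a locally finite smooth partition of unity on $\mathbb R^d$ with compact supports, and let $\psi_j\in\mathcal D(\mathbb R^d)$ be real-valued with $\psi_j=1$ on a neighbourhood of $\operatorname{supp}\chi_j$. The associated embedding is $\iota:\mathcal D'(\mathbb R^d)\to\mathcal G(\mathbb R^d)$, $\iota(w)=\big[\big(\sum_j\chi_j\cdot((\psi_jw)*\rho_\varepsilon)\big)_\varepsilon\big]$.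 For $\alpha\in\mathbb R$: a distribution $w\in\mathcal D'(\mathbb R^d)$ is homogeneous of degree $\alpha$ if $\langle w,\lambda^{-d}\varphi(\cdot/\lambda)\rangle=\lambda^\alpha\langle w,\varphi\rangle$ for all $\lambda>0$ and $\varphi\in\mathcal D(\mathbb R^d)$; $u\in\mathcal G(\mathbb R^d)$ is homogeneous of degree $\alpha$ if $u(\lambda x)=\lambda^\alpha u(x)$ in $\mathcal G(\mathbb R^d)$ for all $\lambda>0$; and $u$ is weakly homogeneous of degree $\alpha$ if $\int u(\lambda x)\varphi(x)\,dx=\int\lambda^\alpha u(x)\varphi(x)\,dx$ in $\widetilde{\mathbb C}$ for all $\lambda>0$ and all $\varphi\in\mathcal D(\mathbb R^d\setminus\{0\})$. Finally, $u$ is associated to $w\in\mathcal D'(\mathbb R^d)$ if $\int u_\varepsilon\varphi\,dx\to\langle w,\varphi\rangle$ as $\varepsilon\to0$ for all $\varphi\in\mathcal D(\mathbb R^d)$. Proposition. For every $d\ge1$ and every embedding $\iota$ as above: (1) Weak homogeneity does not imply homogeneity: for every $\alpha\in\mathbb R$ there is $w\in\mathcal D'(\mathbb R^d)$, homogeneous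 of degree $\alpha$, such that $\iota(w)$ is weakly homogeneous of degree $\alpha$, but $\iota(w)$ is not homogeneous (of any real degree) in $\mathcal G(\mathbb R^d)$. For $\alpha=0$ one may take $w=H\otimes\cdots\otimes H$, with $H$ the Heaviside function: it is homogeneous of degree $0$ in $\mathcal D'(\mathbb R^d)$, and $\iota(w)$ is weakly homogeneous of degree $0$ but not homogeneous of any real degree. (2) For every $\alpha\in\mathbb R$ there is $u\in\mathcal G(\mathbb R^d)$ that is weakly homogeneous of degree $\alpha$ and not associated to any distribution. For $\alpha=0$ one may take the generalized constant $u=[(a_\varepsilon)_\varepsilon]$ with $a_{1/n}=1$ for $n\in\mathbb N$ and $a_\varepsilon=0$ otherwise. -/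

import Mathlib

open Filter Topology MeasureTheory
open scoped ContDiff Distributions SchwartzMap

noncomputable section

namespace Colombeau

/-- `ℝ^d` with its Euclidean structure. -/
abbrev Space (d : ℕ) : Type := EuclideanSpace ℝ (Fin d)

/-- The parameter set `(0, 1]`. -/
abbrev Param : Type := Set.Ioc (0 : ℝ) 1

/-- The filter `ε → 0` on `(0, 1]`. -/
def toZero : Filter Param := comap (fun ε : Param => (ε : ℝ)) (𝓝 0)

/-! ### Generalized numbers -/

/-- Moderate nets of complex numbers. -/
def numModerate : Subalgebra ℂ (Param → ℂ) where
  carrier := {a | ∃ N : ℕ, ∃ C : ℝ, ∀ᶠ ε in toZero, ‖a ε‖ ≤ C * ((ε : ℝ)⁻¹) ^ N}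
  mul_mem' := by
    rintro a b ⟨N, C, h⟩ ⟨N', C', h'⟩
    refine ⟨N + N', C * C', ?_⟩
    filter_upwards [h, h'] with ε h h'
    rw [Pi.mul_apply, norm_mul, pow_add]
    calc ‖a ε‖ * ‖b ε‖ ≤ (C * ((ε : ℝ)⁻¹) ^ N) * (C' * ((ε : ℝ)⁻¹) ^ N') :=
          mul_le_mul h h' (norm_nonneg _) ((norm_nonneg _).trans h)
      _ = _ := by ring
  add_mem' := by
    rintro a b ⟨N, C, h⟩ ⟨N', C', h'⟩
    refine ⟨N + N', |C| + |C'|, ?_⟩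
    filter_upwards [h, h'] with ε h h'
    have h1 : 1 ≤ (ε : ℝ)⁻¹ := (one_le_inv₀ ε.2.1).2 ε.2.2
    have hN : ((ε : ℝ)⁻¹) ^ N ≤ ((ε : ℝ)⁻¹) ^ (N + N') := pow_le_pow_right₀ h1 (by omega)
    have hN' : ((ε : ℝ)⁻¹) ^ N' ≤ ((ε : ℝ)⁻¹) ^ (N + N') := pow_le_pow_right₀ h1 (by omega)
    have h0 : 0 ≤ (ε : ℝ)⁻¹ := zero_le_one.trans h1
    calc ‖a ε + b ε‖ ≤ ‖a ε‖ + ‖b ε‖ := norm_add_le _ _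
      _ ≤ |C| * ((ε : ℝ)⁻¹) ^ (N + N') + |C'| * ((ε : ℝ)⁻¹) ^ (N + N') :=
          add_le_add
            (h.trans (mul_le_mul (le_abs_self _) hN (pow_nonneg h0 _) (abs_nonneg _)))
            (h'.trans (mul_le_mul (le_abs_self _) hN' (pow_nonneg h0 _) (abs_nonneg _)))
      _ = _ := by ring
  algebraMap_mem' := fun c => ⟨0, ‖c‖, Eventually.of_forall fun ε => by simp⟩

/-- Negligible nets of complex numbers, an ideal in the moderate ones. -/
def numNegligible : Ideal numModerate where
  carrier := {a | ∀ m : ℕ, ∃ C : ℝ, ∀ᶠ ε in toZero, ‖(a : Param → ℂ) ε‖ ≤ C * (ε : ℝ) ^ m}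
  add_mem' := by
    intro a b h h' m
    obtain ⟨C, h⟩ := h m
    obtain ⟨C', h'⟩ := h' m
    refine ⟨C + C', ?_⟩
    filter_upwards [h, h'] with ε h h'
    calc ‖(a : Param → ℂ) ε + (b : Param → ℂ) ε‖
          ≤ ‖(a : Param → ℂ) ε‖ + ‖(b : Param → ℂ) ε‖ := norm_add_le _ _
      _ ≤ C * (ε : ℝ) ^ m + C' * (ε : ℝ) ^ m := add_le_add h h'
      _ = _ := by ring
  zero_mem' := fun m => ⟨0, Eventually.of_forall fun ε => by simp⟩
  smul_mem' := by
    intro c a h m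
    obtain ⟨N, D, hc⟩ := c.2
    obtain ⟨C, h⟩ := h (m + N)
    refine ⟨D * C, ?_⟩
    filter_upwards [h, hc] with ε h hc
    have hε : (ε : ℝ) ≠ 0 := ε.2.1.ne'
    calc ‖(c : Param → ℂ) ε * (a : Param → ℂ) ε‖
          = ‖(c : Param → ℂ) ε‖ * ‖(a : Param → ℂ) ε‖ := norm_mul _ _
      _ ≤ (D * ((ε : ℝ)⁻¹) ^ N) * (C * (ε : ℝ) ^ (m + N)) :=
          mul_le_mul hc h (norm_nonneg _) ((norm_nonneg _).trans hc)
      _ = D * C * (ε : ℝ) ^ m := by rw [pow_add, inv_pow]; field_simp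

/-- The ring of (complex) generalized numbers. -/
abbrev GenNum : Type := numModerate ⧸ numNegligible

/-- The generalized number `a` converges to (is associated to) the complex number `z`. -/
def GenNum.IsAssociated (a : GenNum) (z : ℂ) : Prop :=
  ∃ r : numModerate, Ideal.Quotient.mk numNegligible r = a ∧ Tendsto (r : Param → ℂ) toZero (𝓝 z)

/-! ### The special Colombeau algebra on `ℝ^d` -/

/-- Moderate nets of smooth functions. The bound on the Fréchet derivative of order `k` amounts to
the bounds on all partial derivatives of order `k`. -/
def moderate (d : ℕ) : Subalgebra ℂ (Param → Space d → ℂ) where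
  carrier := {u | (∀ ε, ContDiff ℝ ∞ (u ε)) ∧
    ∀ K : Set (Space d), IsCompact K → ∀ k : ℕ, ∃ N : ℕ, ∃ C : ℝ,
      ∀ᶠ ε in toZero, ∀ x ∈ K, ‖iteratedFDeriv ℝ k (u ε) x‖ ≤ C * ((ε : ℝ)⁻¹) ^ N}
  mul_mem' := by
    rintro u v ⟨hu, hu'⟩ ⟨hv, hv'⟩
    refine ⟨fun ε => (hu ε).mul (hv ε), fun K hK k => ?_⟩
    choose N C h using hu' K hK
    choose N' C' h' using hv' K hK
    refine ⟨∑ i ∈ Finset.range (k + 1), (N i + N' (k - i)),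
      ∑ i ∈ Finset.range (k + 1), (k.choose i : ℝ) * |C i| * |C' (k - i)|, ?_⟩
    have H : ∀ᶠ ε in toZero, ∀ i ∈ Finset.range (k + 1), ∀ x ∈ K,
        ‖iteratedFDeriv ℝ i (u ε) x‖ ≤ C i * ((ε : ℝ)⁻¹) ^ N i :=
      (Finset.eventually_all _).2 fun i _ => h i
    have H' : ∀ᶠ ε in toZero, ∀ i ∈ Finset.range (k + 1), ∀ x ∈ K,
        ‖iteratedFDeriv ℝ i (v ε) x‖ ≤ C' i * ((ε : ℝ)⁻¹) ^ N' i :=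
      (Finset.eventually_all _).2 fun i _ => h' i
    filter_upwards [H, H'] with ε H H' x hx
    have h1 : 1 ≤ (ε : ℝ)⁻¹ := (one_le_inv₀ ε.2.1).2 ε.2.2
    have h0 : 0 ≤ (ε : ℝ)⁻¹ := zero_le_one.trans h1
    refine (norm_iteratedFDeriv_mul_le (hu ε) (hv ε) x
      (n := k) (by exact_mod_cast le_top)).trans ?_
    rw [Finset.sum_mul]
    refine Finset.sum_le_sum fun i hi => ?_
    have hi' : k - i ∈ Finset.range (k + 1) := Finset.mem_range.2 (by omega)
    have e1 : ‖iteratedFDeriv ℝ i (u ε) x‖ ≤ |C i| * ((ε : ℝ)⁻¹) ^ N i :=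
      (H i hi x hx).trans (mul_le_mul_of_nonneg_right (le_abs_self _) (pow_nonneg h0 _))
    have e2 : ‖iteratedFDeriv ℝ (k - i) (v ε) x‖ ≤ |C' (k - i)| * ((ε : ℝ)⁻¹) ^ N' (k - i) :=
      (H' _ hi' x hx).trans (mul_le_mul_of_nonneg_right (le_abs_self _) (pow_nonneg h0 _))
    have e3 : ((ε : ℝ)⁻¹) ^ (N i + N' (k - i)) ≤
        ((ε : ℝ)⁻¹) ^ (∑ i ∈ Finset.range (k + 1), (N i + N' (k - i))) :=
      pow_le_pow_right₀ h1
        (Finset.single_le_sum (f := fun i => N i + N' (k - i)) (fun _ _ => Nat.zero_le _) hi)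
    calc (k.choose i : ℝ) * ‖iteratedFDeriv ℝ i (u ε) x‖ * ‖iteratedFDeriv ℝ (k - i) (v ε) x‖
        ≤ (k.choose i : ℝ) * (|C i| * ((ε : ℝ)⁻¹) ^ N i) *
            (|C' (k - i)| * ((ε : ℝ)⁻¹) ^ N' (k - i)) := by gcongr
      _ = (k.choose i : ℝ) * |C i| * |C' (k - i)| * ((ε : ℝ)⁻¹) ^ (N i + N' (k - i)) := by
          rw [pow_add]; ring
      _ ≤ _ := by gcongr
  add_mem' := by
    rintro u v ⟨hu, hu'⟩ ⟨hv, hv'⟩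
    refine ⟨fun ε => (hu ε).add (hv ε), fun K hK k => ?_⟩
    obtain ⟨N, C, h⟩ := hu' K hK k
    obtain ⟨N', C', h'⟩ := hv' K hK k
    refine ⟨N + N', |C| + |C'|, ?_⟩
    filter_upwards [h, h'] with ε h h' x hx
    have h1 : 1 ≤ (ε : ℝ)⁻¹ := (one_le_inv₀ ε.2.1).2 ε.2.2
    have hN : ((ε : ℝ)⁻¹) ^ N ≤ ((ε : ℝ)⁻¹) ^ (N + N') := pow_le_pow_right₀ h1 (by omega)
    have hN' : ((ε : ℝ)⁻¹) ^ N' ≤ ((ε : ℝ)⁻¹) ^ (N + N') := pow_le_pow_right₀ h1 (by omega)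
    have h0 : 0 ≤ (ε : ℝ)⁻¹ := zero_le_one.trans h1
    have hk : ((k : ℕ) : ℕ∞ω) ≤ ∞ := by exact_mod_cast le_top
    rw [Pi.add_apply, iteratedFDeriv_add_apply ((hu ε).of_le hk).contDiffAt
      ((hv ε).of_le hk).contDiffAt]
    calc ‖iteratedFDeriv ℝ k (u ε) x + iteratedFDeriv ℝ k (v ε) x‖
        ≤ ‖iteratedFDeriv ℝ k (u ε) x‖ + ‖iteratedFDeriv ℝ k (v ε) x‖ := norm_add_le _ _
      _ ≤ |C| * ((ε : ℝ)⁻¹) ^ (N + N') + |C'| * ((ε : ℝ)⁻¹) ^ (N + N') :=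
          add_le_add
            ((h x hx).trans (mul_le_mul (le_abs_self _) hN (pow_nonneg h0 _) (abs_nonneg _)))
            ((h' x hx).trans (mul_le_mul (le_abs_self _) hN' (pow_nonneg h0 _) (abs_nonneg _)))
      _ = _ := by ring
  algebraMap_mem' := by
    intro c
    refine ⟨fun ε => contDiff_const, fun K hK k => ⟨0, ‖c‖, Eventually.of_forall fun ε x hx => ?_⟩⟩
    change ‖iteratedFDeriv ℝ k (fun _ : Space d => c) x‖ ≤ _
    rcases k with _ | k
    · simp
    · rw [iteratedFDeriv_const_of_ne (by omega)]; simp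

/-- Negligible nets of smooth functions, an ideal in the moderate ones. -/
def negligible (d : ℕ) : Ideal (moderate d) where
  carrier := {u | ∀ K : Set (Space d), IsCompact K → ∀ k m : ℕ, ∃ C : ℝ,
    ∀ᶠ ε in toZero, ∀ x ∈ K,
      ‖iteratedFDeriv ℝ k ((u : Param → Space d → ℂ) ε) x‖ ≤ C * (ε : ℝ) ^ m}
  add_mem' := by
    intro u v h h' K hK k m
    obtain ⟨C, h⟩ := h K hK k m
    obtain ⟨C', h'⟩ := h' K hK k m
    refine ⟨C + C', ?_⟩
    filter_upwards [h, h'] with ε h h' x hx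
    have hk : ((k : ℕ) : ℕ∞ω) ≤ ∞ := by exact_mod_cast le_top
    change ‖iteratedFDeriv ℝ k ((u : Param → Space d → ℂ) ε + (v : Param → Space d → ℂ) ε) x‖ ≤ _
    rw [iteratedFDeriv_add_apply ((u.2.1 ε).of_le hk).contDiffAt
      ((v.2.1 ε).of_le hk).contDiffAt, add_mul]
    exact (norm_add_le _ _).trans (add_le_add (h x hx) (h' x hx))
  zero_mem' := by
    intro K hK k m
    refine ⟨0, Eventually.of_forall fun ε x hx => ?_⟩
    change ‖iteratedFDeriv ℝ k (fun _ : Space d => (0 : ℂ)) x‖ ≤ _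
    simp [iteratedFDeriv_fun_zero]
  smul_mem' := by
    intro c u h K hK k m
    choose N D hc using c.2.2 K hK
    choose C h using h K hK
    set L := ∑ i ∈ Finset.range (k + 1), N i with hL
    refine ⟨∑ i ∈ Finset.range (k + 1), (k.choose i : ℝ) * |D i| * |C (k - i) (m + L)|, ?_⟩
    have H : ∀ᶠ ε in toZero, ∀ i ∈ Finset.range (k + 1), ∀ x ∈ K,
        ‖iteratedFDeriv ℝ i ((c : Param → Space d → ℂ) ε) x‖ ≤ D i * ((ε : ℝ)⁻¹) ^ N i :=
      (Finset.eventually_all _).2 fun i _ => hc i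
    have H' : ∀ᶠ ε in toZero, ∀ i ∈ Finset.range (k + 1), ∀ x ∈ K,
        ‖iteratedFDeriv ℝ i ((u : Param → Space d → ℂ) ε) x‖ ≤ C i (m + L) * (ε : ℝ) ^ (m + L) :=
      (Finset.eventually_all _).2 fun i _ => h i _
    filter_upwards [H, H'] with ε H H' x hx
    have h1 : 1 ≤ (ε : ℝ)⁻¹ := (one_le_inv₀ ε.2.1).2 ε.2.2
    have h0 : 0 ≤ (ε : ℝ)⁻¹ := zero_le_one.trans h1
    have hε : (ε : ℝ) ≠ 0 := ε.2.1.ne'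
    have hε0 : 0 ≤ (ε : ℝ) := ε.2.1.le
    change ‖iteratedFDeriv ℝ k (fun x => (c : Param → Space d → ℂ) ε x *
      (u : Param → Space d → ℂ) ε x) x‖ ≤ _
    refine (norm_iteratedFDeriv_mul_le (c.2.1 ε) (u.2.1 ε) x
      (n := k) (by exact_mod_cast le_top)).trans ?_
    rw [Finset.sum_mul]
    refine Finset.sum_le_sum fun i hi => ?_
    have hi' : k - i ∈ Finset.range (k + 1) := Finset.mem_range.2 (by omega)
    have e3 : ((ε : ℝ)⁻¹) ^ N i ≤ ((ε : ℝ)⁻¹) ^ L :=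
      pow_le_pow_right₀ h1 (Finset.single_le_sum (fun _ _ => Nat.zero_le _) hi)
    have e1 : ‖iteratedFDeriv ℝ i ((c : Param → Space d → ℂ) ε) x‖ ≤ |D i| * ((ε : ℝ)⁻¹) ^ L :=
      (H i hi x hx).trans (mul_le_mul (le_abs_self _) e3 (pow_nonneg h0 _) (abs_nonneg _))
    have e2 : ‖iteratedFDeriv ℝ (k - i) ((u : Param → Space d → ℂ) ε) x‖ ≤
        |C (k - i) (m + L)| * (ε : ℝ) ^ (m + L) :=
      (H' _ hi' x hx).trans (mul_le_mul_of_nonneg_right (le_abs_self _) (pow_nonneg hε0 _))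
    calc (k.choose i : ℝ) * ‖iteratedFDeriv ℝ i ((c : Param → Space d → ℂ) ε) x‖ *
          ‖iteratedFDeriv ℝ (k - i) ((u : Param → Space d → ℂ) ε) x‖
        ≤ (k.choose i : ℝ) * (|D i| * ((ε : ℝ)⁻¹) ^ L) *
            (|C (k - i) (m + L)| * (ε : ℝ) ^ (m + L)) := by gcongr
      _ = _ := by rw [pow_add, inv_pow]; field_simp

/-- The special Colombeau algebra `𝒢(ℝ^d)`. -/
abbrev Gen (d : ℕ) : Type := moderate d ⧸ negligible d

/-- A generalized number, as a constant generalized function: the map induced by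
`(a_ε)_ε ↦ (x ↦ a_ε)_ε`. -/
def constMod (d : ℕ) : numModerate →ₐ[ℂ] moderate d where
  toFun a := ⟨fun ε _ => (a : Param → ℂ) ε, fun ε => contDiff_const, by
    intro K hK k
    obtain ⟨N, C, h⟩ := a.2
    refine ⟨N, C, ?_⟩
    filter_upwards [h] with ε h x hx
    rcases k with _ | k
    · simpa using h
    · rw [iteratedFDeriv_const_of_ne (by omega)]
      simpa using (norm_nonneg _).trans h⟩
  map_one' := rfl
  map_mul' _ _ := rfl
  map_zero' := rfl
  map_add' _ _ := rfl
  commutes' _ := rfl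

lemma constMod_negligible (d : ℕ) :
    numNegligible ≤ (negligible d).comap (constMod d : numModerate →ₐ[ℂ] moderate d) := by
  intro a ha K hK k m
  obtain ⟨C, h⟩ := ha m
  refine ⟨C, ?_⟩
  filter_upwards [h] with ε h x hx
  change ‖iteratedFDeriv ℝ k (fun _ : Space d => (a : Param → ℂ) ε) x‖ ≤ _
  rcases k with _ | k
  · simpa using h
  · rw [iteratedFDeriv_const_of_ne (by omega)]
    simpa using (norm_nonneg _).trans h

/-- The embedding of the generalized numbers into `𝒢(ℝ^d)` as constants. -/
def Gen.const (d : ℕ) : GenNum →ₐ[ℂ] Gen d :=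
  Ideal.quotientMapₐ (negligible d) (constMod d) (constMod_negligible d)

lemma iteratedFDeriv_scale_le {d : ℕ} {u : Space d → ℂ} (hu : ContDiff ℝ ∞ u) (c : ℝ) (k : ℕ)
    (x : Space d) : ‖iteratedFDeriv ℝ k (fun y => u (c • y)) x‖ ≤
      |c| ^ k * ‖iteratedFDeriv ℝ k u (c • x)‖ := by
  rw [iteratedFDeriv_comp_const_smul c (hu.of_le (by exact_mod_cast le_top)), norm_smul,
    norm_pow, Real.norm_eq_abs]

/-- The map `(u_ε)_ε ↦ (x ↦ u_ε(c x))_ε`. -/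
def scaleMod (d : ℕ) (c : ℝ) : moderate d →ₐ[ℂ] moderate d where
  toFun u := ⟨fun ε x => (u : Param → Space d → ℂ) ε (c • x),
    fun ε => (u.2.1 ε).comp (contDiff_const_smul c), by
      intro K hK k
      obtain ⟨N, C, h⟩ := u.2.2 ((fun x => c • x) '' K) (hK.image (continuous_const_smul c)) k
      refine ⟨N, |c| ^ k * C, ?_⟩
      filter_upwards [h] with ε h x hx
      refine (iteratedFDeriv_scale_le (u.2.1 ε) c k x).trans ?_
      rw [mul_assoc]
      exact mul_le_mul_of_nonneg_left (h _ (Set.mem_image_of_mem _ hx)) (by positivity)⟩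
  map_one' := rfl
  map_mul' _ _ := rfl
  map_zero' := rfl
  map_add' _ _ := rfl
  commutes' _ := rfl

lemma scaleMod_negligible (d : ℕ) (c : ℝ) :
    negligible d ≤ (negligible d).comap (scaleMod d c : moderate d →ₐ[ℂ] moderate d) := by
  intro u hu K hK k m
  obtain ⟨C, h⟩ := hu ((fun x => c • x) '' K) (hK.image (continuous_const_smul c)) k m
  refine ⟨|c| ^ k * C, ?_⟩
  filter_upwards [h] with ε h x hx
  refine (iteratedFDeriv_scale_le (u.2.1 ε) c k x).trans ?_
  rw [mul_assoc]
  exact mul_le_mul_of_nonneg_left (h _ (Set.mem_image_of_mem _ hx)) (by positivity)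

/-- `u(c x)`, for a generalized function `u` and a real number `c`. -/
def Gen.scale {d : ℕ} (c : ℝ) : Gen d →ₐ[ℂ] Gen d :=
  Ideal.quotientMapₐ (negligible d) (scaleMod d c) (scaleMod_negligible d c)

/-- `u` is homogeneous of degree `α`: `u(c x) = c^α u(x)` in `𝒢(ℝ^d)` for all `c > 0`. -/
def Gen.IsHomogeneous {d : ℕ} (u : Gen d) (α : ℝ) : Prop :=
  ∀ c : ℝ, 0 < c → Gen.scale c u = ((c ^ α : ℝ) : ℂ) • u

lemma integrable_mul_test {d : ℕ} {Ω : TopologicalSpace.Opens (Space d)} (φ : 𝓓(Ω, ℂ))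
    {f : Space d → ℂ} (hf : Continuous f) : Integrable (fun x => f x * φ x) :=
  (hf.mul φ.continuous).integrable_of_hasCompactSupport φ.hasCompactSupport.mul_left

lemma norm_integral_mul_test_le {d : ℕ} {Ω : TopologicalSpace.Opens (Space d)} (φ : 𝓓(Ω, ℂ))
    {f : Space d → ℂ} {B : ℝ} (hB : ∀ x ∈ tsupport φ, ‖iteratedFDeriv ℝ 0 f x‖ ≤ B) :
    ‖∫ x, f x * φ x‖ ≤ B * ∫ x, ‖φ x‖ := by
  rw [← integral_const_mul]
  refine norm_integral_le_of_norm_le ?_ (Eventually.of_forall fun x => ?_)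
  · exact ((φ.continuous.norm).integrable_of_hasCompactSupport φ.hasCompactSupport.norm).const_mul B
  · rw [norm_mul]
    by_cases hx : x ∈ tsupport φ
    · have := hB x hx
      rw [norm_iteratedFDeriv_zero] at this
      gcongr
    · simp [image_eq_zero_of_notMem_tsupport hx]

/-- The map `(u_ε)_ε ↦ (∫ u_ε φ dx)_ε`. -/
def pairMod {d : ℕ} {Ω : TopologicalSpace.Opens (Space d)} (φ : 𝓓(Ω, ℂ)) :
    moderate d →+ numModerate where
  toFun u := ⟨fun ε => ∫ x, (u : Param → Space d → ℂ) ε x * φ x, by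
    obtain ⟨N, C, h⟩ := u.2.2 (tsupport φ) φ.hasCompactSupport 0
    refine ⟨N, C * ∫ x, ‖φ x‖, ?_⟩
    filter_upwards [h] with ε h
    refine (norm_integral_mul_test_le φ h).trans (le_of_eq (by ring))⟩
  map_zero' := by ext ε; simp
  map_add' u v := by
    ext ε
    simp only [Subalgebra.coe_add, Pi.add_apply, add_mul]
    exact integral_add (integrable_mul_test φ (u.2.1 ε).continuous)
      (integrable_mul_test φ (v.2.1 ε).continuous)

/-- The integral `∫ u(x) φ(x) dx`, a generalized number. -/
def Gen.pair {d : ℕ} {Ω : TopologicalSpace.Opens (Space d)} (φ : 𝓓(Ω, ℂ)) : Gen d →+ GenNum :=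
  QuotientAddGroup.map (negligible d).toAddSubgroup numNegligible.toAddSubgroup (pairMod φ) (by
    intro u hu m
    obtain ⟨C, h⟩ := hu (tsupport φ) φ.hasCompactSupport 0 m
    refine ⟨C * ∫ x, ‖φ x‖, ?_⟩
    filter_upwards [h] with ε h
    exact (norm_integral_mul_test_le φ h).trans (le_of_eq (by ring)))

lemma Gen.pair_mk {d : ℕ} {Ω : TopologicalSpace.Opens (Space d)} (φ : 𝓓(Ω, ℂ)) (u : moderate d) :
    Gen.pair φ (Ideal.Quotient.mk _ u) = Ideal.Quotient.mk numNegligible (pairMod φ u) := rfl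

/-! ### Distributions and the embedding -/

/-- The space `𝒟'(ℝ^d)`: continuous linear functionals on the complex test functions. -/
abbrev Dist (d : ℕ) : Type := 𝓓((⊤ : TopologicalSpace.Opens (Space d)), ℂ) →L[ℂ] ℂ

/-- The test function `x ↦ c^{-d} φ(x / c)`. -/
def dilate {d : ℕ} (c : ℝ) (hc : 0 < c) (φ : 𝓓((⊤ : TopologicalSpace.Opens (Space d)), ℂ)) :
    𝓓((⊤ : TopologicalSpace.Opens (Space d)), ℂ) where
  toFun x := (((c ^ d)⁻¹ : ℝ) : ℂ) * φ (c⁻¹ • x)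
  contDiff' := contDiff_const.mul (φ.contDiff.comp (contDiff_const_smul c⁻¹))
  hasCompactSupport' :=
    (φ.hasCompactSupport.comp_homeomorph
      (Homeomorph.smulOfNeZero c⁻¹ (inv_ne_zero hc.ne'))).mul_left
  tsupport_subset' := fun _ _ => trivial

/-- `w` is homogeneous of degree `α` in `𝒟'(ℝ^d)`. -/
def Dist.IsHomogeneous {d : ℕ} (w : Dist d) (α : ℝ) : Prop :=
  ∀ (c : ℝ) (hc : 0 < c) (φ : 𝓓((⊤ : TopologicalSpace.Opens (Space d)), ℂ)),
    w (dilate c hc φ) = ((c ^ α : ℝ) : ℂ) * w φ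

/-- A Schwartz mollifier with integral one and all higher moments vanishing. -/
structure Mollifier (d : ℕ) where
  /-- the underlying Schwartz function -/
  ρ : 𝓢(Space d, ℂ)
  integral_eq_one : ∫ x, ρ x = 1
  moments : ∀ β : Fin d → ℕ, β ≠ 0 → ∫ x, (∏ i, ((x i : ℝ) : ℂ) ^ β i) * ρ x = 0

/-- A relatively compact, locally finite smooth partition of unity `χ_j` on `ℝ^d`, with cut-off
functions `ψ_j` which are equal to `1` on a neighbourhood of the support of `χ_j`. -/
structure CutoffSystem (d : ℕ) where
  /-- the partition of unity -/
  χ : ℕ → 𝓓((⊤ : TopologicalSpace.Opens (Space d)), ℝ)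
  /-- the cut-off functions -/
  ψ : ℕ → 𝓓((⊤ : TopologicalSpace.Opens (Space d)), ℝ)
  nonneg : ∀ j x, 0 ≤ χ j x
  locallyFinite : LocallyFinite fun j => Function.support (χ j)
  sum_eq_one : ∀ x, ∑ᶠ j, χ j x = 1
  cutoff : ∀ j, ∀ᶠ x in 𝓝ˢ (tsupport (χ j)), ψ j x = 1

/-- `ρ_ε(x) = ε^{-d} ρ(x / ε)`. -/
def Mollifier.scaled {d : ℕ} (ρ : Mollifier d) (ε : Param) (x : Space d) : ℂ :=
  ((((ε : ℝ) ^ d)⁻¹ : ℝ) : ℂ) * ρ.ρ ((ε : ℝ)⁻¹ • x)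

lemma Mollifier.contDiff_scaled {d : ℕ} (ρ : Mollifier d) (ε : Param) :
    ContDiff ℝ ∞ (ρ.scaled ε) :=
  contDiff_const.mul ((ρ.ρ.smooth _).comp (contDiff_const_smul _))

/-- The test function `y ↦ ψ(y) g(y)`, for a test function `ψ` and a smooth function `g`. -/
def cutTest {d : ℕ} (ψ : 𝓓((⊤ : TopologicalSpace.Opens (Space d)), ℝ)) (g : Space d → ℂ)
    (hg : ContDiff ℝ ∞ g) : 𝓓((⊤ : TopologicalSpace.Opens (Space d)), ℂ) where
  toFun y := ψ y • g y
  contDiff' := ψ.contDiff.smul hg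
  hasCompactSupport' := ψ.hasCompactSupport.smul_right
  tsupport_subset' := fun _ _ => trivial

/-- The convolution `(ψ w) * g`, that is, `x ↦ ⟨w(y), ψ(y) g(x - y)⟩`. -/
def cutConv {d : ℕ} (w : Dist d) (ψ : 𝓓((⊤ : TopologicalSpace.Opens (Space d)), ℝ))
    (g : Space d → ℂ) (hg : ContDiff ℝ ∞ g) (x : Space d) : ℂ :=
  w (cutTest ψ (fun y => g (x - y)) (hg.comp (contDiff_const.sub contDiff_id)))

/-- The net `Σ_j χ_j · ((ψ_j w) * ρ_ε)`. -/
def embedNet {d : ℕ} (ρ : Mollifier d) (P : CutoffSystem d) (w : Dist d) (ε : Param)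
    (x : Space d) : ℂ :=
  ∑ᶠ j, (P.χ j x : ℂ) * cutConv w (P.ψ j) (ρ.scaled ε) (ρ.contDiff_scaled ε) x

lemma le_inf (k : ℕ) : ((k : ℕ) : ℕ∞ω) ≤ ∞ := by exact_mod_cast le_top

/-- Continuity estimate for `f ↦ ⟨w, ψ f⟩`. -/
lemma exists_cutTest_bound {d : ℕ} (w : Dist d)
    (ψ : 𝓓((⊤ : TopologicalSpace.Opens (Space d)), ℝ)) :
    ∃ (n : ℕ) (C : ℝ), 0 ≤ C ∧ ∀ (f : Space d → ℂ) (hf : ContDiff ℝ ∞ f) (M : ℝ),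
      (∀ i ≤ n, ∀ y, ‖iteratedFDeriv ℝ i f y‖ ≤ M) → ‖w (cutTest ψ f hf)‖ ≤ C * M := by
  classical
  let K : TopologicalSpace.Compacts (Space d) := ⟨tsupport ψ, ψ.hasCompactSupport⟩
  have hK : (K : Set (Space d)) ⊆ (⊤ : TopologicalSpace.Opens (Space d)) := fun _ _ => trivial
  let T := w.comp (TestFunction.ofSupportedInCLM ℂ (n := ⊤) (F := ℂ) hK)
  obtain ⟨s, C, -, hC⟩ := Seminorm.bound_of_continuous
    (ContDiffMapSupportedIn.withSeminorms ℂ (Space d) ℂ ⊤ K)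
    ((normSeminorm ℂ ℂ).comp T.toLinearMap) (continuous_norm.comp T.continuous)
  have hb : ∀ i : ℕ, ∃ B : ℝ, ∀ x, ‖iteratedFDeriv ℝ i ψ x‖ ≤ B := fun i =>
    Continuous.bounded_above_of_compact_support
      (ψ.contDiff.continuous_iteratedFDeriv (le_inf i)) (ψ.hasCompactSupport.iteratedFDeriv i)
  choose B hB using hb
  have hB0 : ∀ i, 0 ≤ B i := fun i => (norm_nonneg _).trans (hB i 0)
  refine ⟨s.sup id, C * ∑ i ∈ s, ∑ j ∈ Finset.range (i + 1), (i.choose j : ℝ) * B j,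
    mul_nonneg C.2 (Finset.sum_nonneg fun i _ => Finset.sum_nonneg fun j _ =>
      mul_nonneg (Nat.cast_nonneg _) (hB0 j)), fun f hf M hM => ?_⟩
  have hM0 : 0 ≤ M := (norm_nonneg _).trans (hM 0 (Nat.zero_le _) 0)
  let φ : ContDiffMapSupportedIn (Space d) ℂ ⊤ K := .of_support_subset (f := fun y => ψ y • f y)
    (ψ.contDiff.smul hf)
    (fun y hy => subset_closure fun h => hy (by simp [h]))
  have hφ : w (cutTest ψ f hf) = T φ := rfl
  rw [hφ, mul_assoc]
  have h1 := hC φ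
  refine (show ‖T φ‖ ≤ _ from h1).trans ?_
  rw [smul_apply]
  refine mul_le_mul_of_nonneg_left ?_ C.2
  refine Seminorm.finset_sup_apply_le (mul_nonneg (Finset.sum_nonneg fun i _ =>
    Finset.sum_nonneg fun j _ => mul_nonneg (Nat.cast_nonneg _) (hB0 j)) hM0) fun i hi => ?_
  have hterm : ∀ x, ‖iteratedFDeriv ℝ i φ x‖ ≤
      (∑ j ∈ Finset.range (i + 1), (i.choose j : ℝ) * B j) * M := by
    intro x
    refine (norm_iteratedFDeriv_smul_le ψ.contDiff hf x (n := i) (le_inf i)).trans ?_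
    rw [Finset.sum_mul]
    refine Finset.sum_le_sum fun j hj => ?_
    have : i - j ≤ s.sup id := (Nat.sub_le i j).trans (Finset.le_sup (f := id) hi)
    exact mul_le_mul (mul_le_mul_of_nonneg_left (hB j x) (Nat.cast_nonneg _)) (hM _ this x)
      (norm_nonneg _) (mul_nonneg (Nat.cast_nonneg _) (hB0 j))
  refine ((ContDiffMapSupportedIn.seminorm_top_le_iff ℂ
    ((norm_nonneg _).trans (hterm 0)) i φ).2 fun x _ => hterm x).trans ?_
  refine mul_le_mul_of_nonneg_right ?_ hM0
  exact Finset.single_le_sum (f := fun i => ∑ j ∈ Finset.range (i + 1), (i.choose j : ℝ) * B j)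
    (fun i _ => Finset.sum_nonneg fun j _ => mul_nonneg (Nat.cast_nonneg _) (hB0 j)) hi

lemma cutTest_add {d : ℕ} (ψ : 𝓓((⊤ : TopologicalSpace.Opens (Space d)), ℝ)) {f g : Space d → ℂ}
    (hf : ContDiff ℝ ∞ f) (hg : ContDiff ℝ ∞ g) (hfg : ContDiff ℝ ∞ (fun y => f y + g y)) :
    cutTest ψ (fun y => f y + g y) hfg = cutTest ψ f hf + cutTest ψ g hg := by
  ext y; exact smul_add _ _ _

lemma cutTest_smul {d : ℕ} (ψ : 𝓓((⊤ : TopologicalSpace.Opens (Space d)), ℝ)) {f : Space d → ℂ}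
    (hf : ContDiff ℝ ∞ f) (c : ℂ) (hcf : ContDiff ℝ ∞ (fun y => c * f y)) :
    cutTest ψ (fun y => c * f y) hcf = c • cutTest ψ f hf := by
  ext y; change ψ y • (c * f y) = c * (ψ y • f y); simp only [Complex.real_smul]; ring

/-- Second order Taylor estimate for all derivatives. -/
lemma taylor_bound {E : Type} [NormedAddCommGroup E] [NormedSpace ℝ E] (k : ℕ) :
    ∀ {F : Type} [NormedAddCommGroup F] [NormedSpace ℝ F] (g : E → F) (_ : ContDiff ℝ ∞ g)
      (M : ℝ) (_ : ∀ z, ‖iteratedFDeriv ℝ (k + 2) g z‖ ≤ M) (h z : E),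
      ‖iteratedFDeriv ℝ k (fun z => g (z + h) - g z - fderiv ℝ g z h) z‖ ≤ M * ‖h‖ ^ 2 := by
  induction k with
  | zero =>
    intro F _ _ g hg M hM h z
    have hM0 : 0 ≤ M := (norm_nonneg _).trans (hM z)
    have hg' : ContDiff ℝ ∞ (fderiv ℝ g) := hg.fderiv_right (by simp)
    have hd : ∀ x, DifferentiableAt ℝ g x := fun x => hg.differentiable (by simp) x
    have hd' : ∀ x, DifferentiableAt ℝ (fderiv ℝ g) x := fun x => hg'.differentiable (by simp) x
    have h2 : ∀ x, ‖fderiv ℝ (fderiv ℝ g) x‖ ≤ M := fun x => by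
      have := hM x
      rw [← norm_iteratedFDeriv_fderiv, ← norm_iteratedFDeriv_fderiv,
        norm_iteratedFDeriv_zero] at this
      exact this
    rw [norm_iteratedFDeriv_zero]
    have key := (convex_segment z (z + h)).norm_image_sub_le_of_norm_fderiv_le' (𝕜 := ℝ) (f := g)
      (φ := fderiv ℝ g z) (C := M * ‖h‖) (x := z) (y := z + h) (fun x _ => hd x)
      (fun x hx => ?_) (left_mem_segment ℝ _ _) (right_mem_segment ℝ _ _)
    · simpa [pow_two, mul_assoc] using key
    · have h3 := convex_univ.norm_image_sub_le_of_norm_fderiv_le (𝕜 := ℝ) (f := fderiv ℝ g)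
        (C := M) (x := z) (y := x) (fun x _ => hd' x) (fun x _ => h2 x) trivial trivial
      refine h3.trans (mul_le_mul_of_nonneg_left ?_ hM0)
      have := norm_sub_le_of_mem_segment hx
      simpa using this
  | succ k ih =>
    intro F _ _ g hg M hM h z
    have hg' : ContDiff ℝ ∞ (fderiv ℝ g) := hg.fderiv_right (by simp)
    have hd : ∀ x, DifferentiableAt ℝ g x := fun x => hg.differentiable (by simp) x
    have hd' : ∀ x, DifferentiableAt ℝ (fderiv ℝ g) x := fun x => hg'.differentiable (by simp) x
    have hM' : ∀ z, ‖iteratedFDeriv ℝ (k + 2) (fderiv ℝ g) z‖ ≤ M := fun z => by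
      rw [norm_iteratedFDeriv_fderiv]; exact hM z
    rw [← norm_iteratedFDeriv_fderiv]
    have e : fderiv ℝ (fun z => g (z + h) - g z - fderiv ℝ g z h) =
        fun z => fderiv ℝ g (z + h) - fderiv ℝ g z - fderiv ℝ (fderiv ℝ g) z h := by
      funext y
      have a1 : HasFDerivAt (fun z => g (z + h)) (fderiv ℝ g (y + h)) y :=
        (hd (y + h)).hasFDerivAt.comp y ((hasFDerivAt_id y).add_const h)
      have a3 : HasFDerivAt (fun z => fderiv ℝ g z h) ((ContinuousLinearMap.apply ℝ F h).comp
          (fderiv ℝ (fderiv ℝ g) y)) y :=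
        (ContinuousLinearMap.apply ℝ F h).hasFDerivAt.comp y (hd' y).hasFDerivAt
      refine ((a1.sub (hd y).hasFDerivAt).sub a3).fderiv.trans ?_
      congr 1
      ext v
      exact second_derivative_symmetric (fun x => (hd x).hasFDerivAt) (hd' y).hasFDerivAt v h
    rw [e]
    exact ih (fderiv ℝ g) hg' M hM' h z

lemma norm_iteratedFDeriv_reflect {d : ℕ} (r : Space d → ℂ) (x y : Space d) (i : ℕ) :
    ‖iteratedFDeriv ℝ i (fun y => r (x - y)) y‖ = ‖iteratedFDeriv ℝ i r (x - y)‖ := by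
  have := (LinearIsometryEquiv.neg ℝ (E := Space d)).norm_iteratedFDeriv_comp_right
    (fun z => r (x + z)) y i
  rw [iteratedFDeriv_comp_add_left] at this
  simpa [Function.comp_def, sub_eq_add_neg] using this

lemma contDiff_dirDeriv {d : ℕ} {g : Space d → ℂ} (hg : ContDiff ℝ ∞ g) (v : Space d) :
    ContDiff ℝ ∞ (fun z => fderiv ℝ g z v) :=
  (hg.fderiv_right (by simp)).clm_apply contDiff_const

lemma norm_dirDeriv_le {d : ℕ} {g : Space d → ℂ} (hg : ContDiff ℝ ∞ g) (v z : Space d) (i : ℕ) :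
    ‖iteratedFDeriv ℝ i (fun z => fderiv ℝ g z v) z‖ ≤ ‖v‖ * ‖iteratedFDeriv ℝ (i + 1) g z‖ := by
  have hg' : ContDiff ℝ ∞ (fderiv ℝ g) := hg.fderiv_right (by simp)
  rw [← norm_iteratedFDeriv_fderiv]
  exact norm_iteratedFDeriv_clm_apply_const hg'.contDiffAt (le_inf i)

lemma hasFDerivAt_cutConv {d : ℕ} (w : Dist d) (ψ : 𝓓((⊤ : TopologicalSpace.Opens (Space d)), ℝ))
    {g : Space d → ℂ} (hg : ContDiff ℝ ∞ g) (hb : ∀ i, ∃ M, ∀ z, ‖iteratedFDeriv ℝ i g z‖ ≤ M)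
    (x : Space d) : ∃ L : Space d →L[ℝ] ℂ, HasFDerivAt (cutConv w ψ g hg) L x ∧
      ∀ v, L v = cutConv w ψ (fun z => fderiv ℝ g z v) (contDiff_dirDeriv hg v) x := by
  obtain ⟨n, C, hC, hw⟩ := exists_cutTest_bound w ψ
  let L₀ : Space d →ₗ[ℝ] ℂ :=
    { toFun := fun v => cutConv w ψ (fun z => fderiv ℝ g z v) (contDiff_dirDeriv hg v) x
      map_add' := by
        intro v v'
        unfold cutConv
        rw [← map_add]
        congr 1
        ext y
        change ψ y • fderiv ℝ g (x - y) (v + v') =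
          ψ y • fderiv ℝ g (x - y) v + ψ y • fderiv ℝ g (x - y) v'
        rw [map_add, smul_add]
      map_smul' := by
        intro c v
        unfold cutConv
        have : ∀ z : ℂ, (RingHom.id ℝ) c • z = (c : ℂ) • z := fun z => by simp
        rw [this, ← map_smul]
        congr 1
        ext y
        change ψ y • fderiv ℝ g (x - y) (c • v) = (c : ℂ) * (ψ y • fderiv ℝ g (x - y) v)
        simp only [map_smul, Complex.real_smul]
        ring }
  refine ⟨LinearMap.toContinuousLinearMap L₀, ?_, fun v => rfl⟩
  choose M hM using hb
  have hM0 : ∀ i, 0 ≤ M i := fun i => (norm_nonneg _).trans (hM i 0)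
  rw [hasFDerivAt_iff_isLittleO_nhds_zero]
  have hbig : (fun h : Space d => cutConv w ψ g hg (x + h) - cutConv w ψ g hg x -
      LinearMap.toContinuousLinearMap L₀ h) =O[𝓝 0] fun h : Space d => ‖h‖ ^ 2 := by
    refine Asymptotics.IsBigO.of_bound (C * ∑ i ∈ Finset.range (n + 1), M (i + 2))
      (Eventually.of_forall fun h => ?_)
    have hr : ContDiff ℝ ∞ (fun z => g (z + h) - g z - fderiv ℝ g z h) :=
      ((hg.comp (contDiff_id.add contDiff_const)).sub hg).sub (contDiff_dirDeriv hg h)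
    have e : cutConv w ψ g hg (x + h) - cutConv w ψ g hg x - LinearMap.toContinuousLinearMap L₀ h =
        w (cutTest ψ (fun y => (fun z => g (z + h) - g z - fderiv ℝ g z h) (x - y))
          (hr.comp (contDiff_const.sub contDiff_id))) := by
      change w _ - w _ - w _ = _
      rw [← map_sub, ← map_sub]
      congr 1
      ext y
      change ψ y • g (x + h - y) - ψ y • g (x - y) - ψ y • fderiv ℝ g (x - y) h =
        ψ y • (g (x - y + h) - g (x - y) - fderiv ℝ g (x - y) h)
      rw [smul_sub, smul_sub, show x + h - y = x - y + h by abel]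
    rw [e, norm_pow, norm_norm, mul_assoc]
    refine hw _ _ _ fun i hi y => ?_
    rw [norm_iteratedFDeriv_reflect (fun z => g (z + h) - g z - fderiv ℝ g z h)]
    refine (taylor_bound i g hg _ (hM (i + 2)) h _).trans ?_
    refine mul_le_mul_of_nonneg_right ?_ (by positivity)
    exact Finset.single_le_sum (f := fun i => M (i + 2)) (fun i _ => hM0 _)
      (Finset.mem_range.2 (by omega))
  refine hbig.trans_isLittleO ?_
  have := Asymptotics.isLittleO_norm_pow_id (E' := Space d) (n := 2) (by norm_num)
  simpa using this

lemma cutConv_aux {d : ℕ} (w : Dist d) (ψ : 𝓓((⊤ : TopologicalSpace.Opens (Space d)), ℝ))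
    {n : ℕ} {C : ℝ}
    (hw : ∀ (f : Space d → ℂ) (hf : ContDiff ℝ ∞ f) (M : ℝ),
      (∀ i ≤ n, ∀ y, ‖iteratedFDeriv ℝ i f y‖ ≤ M) → ‖w (cutTest ψ f hf)‖ ≤ C * M) (k : ℕ) :
    ∀ (g : Space d → ℂ) (hg : ContDiff ℝ ∞ g)
      (_ : ∀ i, ∃ M, ∀ z, ‖iteratedFDeriv ℝ i g z‖ ≤ M),
      ContDiff ℝ k (cutConv w ψ g hg) ∧
      ∀ M, (∀ i ≤ n + k, ∀ z, ‖iteratedFDeriv ℝ i g z‖ ≤ M) → ∀ (x : Space d)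
        (m : Fin k → Space d),
        ‖iteratedFDeriv ℝ k (cutConv w ψ g hg) x m‖ ≤ C * M * ∏ j, ‖m j‖ := by
  induction k with
  | zero =>
    intro g hg hb
    refine ⟨?_, fun M hM x m => ?_⟩
    · refine contDiff_zero.2 (continuous_iff_continuousAt.2 fun x => ?_)
      obtain ⟨L, hL, -⟩ := hasFDerivAt_cutConv w ψ hg hb x
      exact hL.continuousAt
    · simp only [iteratedFDeriv_zero_apply, Finset.univ_eq_empty, Finset.prod_empty, mul_one]
      refine hw _ _ M fun i hi y => ?_
      rw [norm_iteratedFDeriv_reflect g]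
      exact hM i (by omega) _
  | succ k ih =>
    intro g hg hb
    have hd : ∀ v, (fun x => fderiv ℝ (cutConv w ψ g hg) x v) =
        cutConv w ψ (fun z => fderiv ℝ g z v) (contDiff_dirDeriv hg v) := by
      intro v
      funext x
      obtain ⟨L, hL, hL'⟩ := hasFDerivAt_cutConv w ψ hg hb x
      rw [hL.fderiv, hL']
    have hb' : ∀ v : Space d, ∀ i, ∃ M, ∀ z,
        ‖iteratedFDeriv ℝ i (fun z => fderiv ℝ g z v) z‖ ≤ M := by
      intro v i
      obtain ⟨M, hM⟩ := hb (i + 1)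
      exact ⟨‖v‖ * M, fun z => (norm_dirDeriv_le hg v z i).trans
        (mul_le_mul_of_nonneg_left (hM z) (norm_nonneg _))⟩
    have hcd : ContDiff ℝ (k + 1 : ℕ) (cutConv w ψ g hg) := by
      push_cast
      refine contDiff_succ_iff_fderiv_apply.2 ⟨fun x => ?_, fun h => ?_, fun v => ?_⟩
      · obtain ⟨L, hL, -⟩ := hasFDerivAt_cutConv w ψ hg hb x
        exact hL.differentiableAt
      · exact absurd h (by simp)
      · rw [hd v]
        exact (ih _ _ (hb' v)).1
    refine ⟨hcd, fun M hM x m => ?_⟩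
    have e : iteratedFDeriv ℝ (k + 1) (cutConv w ψ g hg) x m =
        iteratedFDeriv ℝ k (fun y => fderiv ℝ (cutConv w ψ g hg) y (m (Fin.last k))) x
          (Fin.init m) := by
      rw [iteratedFDeriv_succ_apply_right]
      have hf : ContDiff ℝ k (fderiv ℝ (cutConv w ψ g hg)) := hcd.fderiv_right (by norm_cast)
      exact (iteratedFDeriv_clm_apply_const_apply hf le_rfl).symm
    rw [e, hd]
    refine ((ih _ _ (hb' (m (Fin.last k)))).2 (‖m (Fin.last k)‖ * M) (fun i hi z => ?_) x
      (Fin.init m)).trans (le_of_eq ?_)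
    · exact (norm_dirDeriv_le hg _ z i).trans
        (mul_le_mul_of_nonneg_left (hM _ (by omega) z) (norm_nonneg _))
    · rw [Fin.prod_univ_castSucc]
      simp only [Fin.init]
      ring

lemma norm_scaled_le {d : ℕ} (ρ : Mollifier d) (i : ℕ) : ∃ M, 0 ≤ M ∧ ∀ (ε : Param) z,
    ‖iteratedFDeriv ℝ i (ρ.scaled ε) z‖ ≤ M * ((ε : ℝ)⁻¹) ^ (d + i) := by
  obtain ⟨M, hM⟩ := ρ.ρ.decay 0 i
  refine ⟨M, hM.1.le, fun ε z => ?_⟩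
  have h0 : 0 ≤ (ε : ℝ)⁻¹ := inv_nonneg.2 ε.2.1.le
  have hs : ContDiff ℝ ∞ (fun z => ρ.ρ ((ε : ℝ)⁻¹ • z)) :=
    (ρ.ρ.smooth _).comp (contDiff_const_smul _)
  have e := iteratedFDeriv_const_smul_apply' (𝕜 := ℝ) (i := i) (x := z)
    (a := (((((ε : ℝ) ^ d)⁻¹ : ℝ) : ℂ))) (hs.of_le (le_inf i)).contDiffAt
  change ‖iteratedFDeriv ℝ i (fun z => ((((ε : ℝ) ^ d)⁻¹ : ℝ) : ℂ) • ρ.ρ ((ε : ℝ)⁻¹ • z)) z‖ ≤ _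
  rw [e, norm_smul, Complex.norm_real, Real.norm_eq_abs, abs_of_nonneg (inv_nonneg.2 (pow_nonneg ε.2.1.le d)),
    pow_add, inv_pow]
  have h2 := hM.2 ((ε : ℝ)⁻¹ • z)
  rw [pow_zero, one_mul] at h2
  calc ((ε : ℝ) ^ d)⁻¹ * ‖iteratedFDeriv ℝ i (fun z => ρ.ρ ((ε : ℝ)⁻¹ • z)) z‖
      ≤ ((ε : ℝ) ^ d)⁻¹ * (((ε : ℝ)⁻¹) ^ i * M) := by
        refine mul_le_mul_of_nonneg_left ?_ (inv_nonneg.2 (pow_nonneg ε.2.1.le d))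
        refine (iteratedFDeriv_scale_le (ρ.ρ.smooth _) _ i z).trans ?_
        rw [abs_of_nonneg h0]
        exact mul_le_mul_of_nonneg_left h2 (pow_nonneg h0 i)
    _ = _ := by ring

lemma cutConv_mem_moderate {d : ℕ} (ρ : Mollifier d) (w : Dist d)
    (ψ : 𝓓((⊤ : TopologicalSpace.Opens (Space d)), ℝ)) :
    (fun ε => cutConv w ψ (ρ.scaled ε) (ρ.contDiff_scaled ε)) ∈ moderate d := by
  obtain ⟨n, C, hC, hw⟩ := exists_cutTest_bound w ψ
  choose M hM0 hM using norm_scaled_le ρ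
  have hb : ∀ (ε : Param) i, ∃ M, ∀ z, ‖iteratedFDeriv ℝ i (ρ.scaled ε) z‖ ≤ M :=
    fun ε i => ⟨_, hM i ε⟩
  refine ⟨fun ε => contDiff_infty.2 fun k => (cutConv_aux w ψ hw k _ _ (hb ε)).1,
    fun K hK k => ⟨d + (n + k), C * ∑ i ∈ Finset.range (n + k + 1), M i,
      Eventually.of_forall fun ε x hx => ?_⟩⟩
  have h1 : 1 ≤ (ε : ℝ)⁻¹ := (one_le_inv₀ ε.2.1).2 ε.2.2
  have h0 : 0 ≤ (ε : ℝ)⁻¹ := zero_le_one.trans h1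
  have hS : 0 ≤ ∑ i ∈ Finset.range (n + k + 1), M i := Finset.sum_nonneg fun i _ => hM0 i
  refine ContinuousMultilinearMap.opNorm_le_bound (by positivity) fun m => ?_
  rw [mul_assoc C]
  refine (cutConv_aux w ψ hw k _ _ (hb ε)).2 _ (fun i hi z => ?_) x m
  refine (hM i ε z).trans (mul_le_mul ?_ (pow_le_pow_right₀ h1 (by omega)) (pow_nonneg h0 _) hS)
  exact Finset.single_le_sum (fun i _ => hM0 i) (Finset.mem_range.2 (by omega))

lemma const_mem_moderate {d : ℕ} {f : Space d → ℂ} (hf : ContDiff ℝ ∞ f) :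
    (fun _ => f) ∈ moderate d := by
  refine ⟨fun _ => hf, fun K hK k => ?_⟩
  obtain ⟨B, hB⟩ := hK.exists_bound_of_continuousOn
    (hf.continuous_iteratedFDeriv (le_inf k)).continuousOn
  exact ⟨0, B, Eventually.of_forall fun ε x hx => by simpa using hB x hx⟩

lemma embedNet_local {d : ℕ} (ρ : Mollifier d) (P : CutoffSystem d) (w : Dist d)
    {K : Set (Space d)} (hK : IsCompact K) : ∃ S : Finset ℕ, ∀ ε, ∀ x ∈ Metric.thickening 1 K,
      embedNet ρ P w ε x = (∑ j ∈ S, (fun (_ : Param) (x : Space d) => (P.χ j x : ℂ)) *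
        fun ε => cutConv w (P.ψ j) (ρ.scaled ε) (ρ.contDiff_scaled ε)) ε x := by
  have hfin := P.locallyFinite.finite_nonempty_inter_compact (hK.cthickening (r := 1))
  refine ⟨hfin.toFinset, fun ε x hx => ?_⟩
  rw [Finset.sum_apply, Finset.sum_apply]
  refine finsum_eq_sum_of_support_subset _ fun j hj => ?_
  simp only [Set.Finite.coe_toFinset, Set.mem_ofPred_eq]
  refine ⟨x, fun h => hj ?_, Metric.thickening_subset_cthickening _ _ hx⟩
  simp [h]

lemma embedNet_mem_moderate {d : ℕ} (ρ : Mollifier d) (P : CutoffSystem d) (w : Dist d) :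
    embedNet ρ P w ∈ moderate d := by
  have hS : ∀ S : Finset ℕ, (∑ j ∈ S, (fun (_ : Param) (x : Space d) => (P.χ j x : ℂ)) *
      fun ε => cutConv w (P.ψ j) (ρ.scaled ε) (ρ.contDiff_scaled ε)) ∈ moderate d := fun S =>
    Subalgebra.sum_mem _ fun j _ => Subalgebra.mul_mem _
      (const_mem_moderate (Complex.ofRealCLM.contDiff.comp (P.χ j).contDiff))
      (cutConv_mem_moderate ρ w (P.ψ j))
  refine ⟨fun ε => contDiff_iff_contDiffAt.2 fun x => ?_, fun K hK k => ?_⟩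
  · obtain ⟨S, h⟩ := embedNet_local ρ P w (isCompact_singleton (x := x))
    refine ((hS S).1 ε).contDiffAt.congr_of_eventuallyEq ?_
    filter_upwards [Metric.isOpen_thickening.mem_nhds
      (Metric.self_subset_thickening one_pos {x} rfl)] with y hy using h ε y hy
  · obtain ⟨S, h⟩ := embedNet_local ρ P w hK
    obtain ⟨N, C, hC⟩ := (hS S).2 K hK k
    refine ⟨N, C, ?_⟩
    filter_upwards [hC] with ε hC x hx
    have : embedNet ρ P w ε =ᶠ[𝓝 x] (∑ j ∈ S, (fun (_ : Param) (x : Space d) => (P.χ j x : ℂ)) *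
        fun ε => cutConv w (P.ψ j) (ρ.scaled ε) (ρ.contDiff_scaled ε)) ε := by
      filter_upwards [Metric.isOpen_thickening.mem_nhds
        (Metric.self_subset_thickening one_pos K hx)] with y hy using h ε y hy
    rw [(this.iteratedFDeriv ℝ k).eq_of_nhds]
    exact hC x hx

/-- The embedding `ι_ρ : 𝒟'(ℝ^d) → 𝒢(ℝ^d)`. -/
def embed {d : ℕ} (ρ : Mollifier d) (P : CutoffSystem d) (w : Dist d) : Gen d :=
  Ideal.Quotient.mk (negligible d) ⟨embedNet ρ P w, embedNet_mem_moderate ρ P w⟩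

/-! ### Weak homogeneity, association and the two examples -/

/-- `u` is weakly homogeneous of degree `α`: for all `c > 0` and all test functions `φ` on
`ℝ^d \ {0}`, `∫ u(c x) φ(x) dx = ∫ c^α u(x) φ(x) dx` as generalized numbers. -/
def Gen.IsWeaklyHomogeneous {d : ℕ} (u : Gen d) (α : ℝ) : Prop :=
  ∀ c : ℝ, 0 < c → ∀ φ : 𝓓((⟨{0}ᶜ, isOpen_compl_singleton⟩ : TopologicalSpace.Opens (Space d)), ℂ),
    Gen.pair φ (Gen.scale c u) = Gen.pair φ (((c ^ α : ℝ) : ℂ) • u)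

/-- `u` is associated to the distribution `w`. -/
def Gen.IsAssociated {d : ℕ} (u : Gen d) (w : Dist d) : Prop :=
  ∀ φ : 𝓓((⊤ : TopologicalSpace.Opens (Space d)), ℂ), (Gen.pair φ u).IsAssociated (w φ)

/-- The Heaviside function. -/
def heaviside (t : ℝ) : ℂ := if 0 < t then 1 else 0

lemma locallyIntegrable_heaviside (d : ℕ) :
    LocallyIntegrable (fun x : Space d => ∏ i, heaviside (x i)) := by
  refine (locallyIntegrable_const (1 : ℂ)).mono ?_ (Eventually.of_forall fun x => ?_)
  · refine (Finset.measurable_prod _ fun i _ => ?_).aestronglyMeasurable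
    exact (Measurable.ite measurableSet_Ioi measurable_const measurable_const).comp
      (by fun_prop : Measurable fun x : Space d => x i)
  · rw [norm_prod, norm_one]
    refine Finset.prod_le_one (fun i _ => norm_nonneg _) fun i _ => ?_
    unfold heaviside
    split_ifs <;> simp

/-- The distribution `H ⊗ ⋯ ⊗ H` on `ℝ^d`, that is, the regular distribution with density
`x ↦ H(x_1) ⋯ H(x_d)`. -/
def heavisideTensor (d : ℕ) : Dist d :=
  TestFunction.integralAgainstBilinCLM (ContinuousLinearMap.mul ℂ ℂ) volume
    (fun x : Space d => ∏ i, heaviside (x i))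

lemma heavisideTensor_apply (d : ℕ) (φ : 𝓓((⊤ : TopologicalSpace.Opens (Space d)), ℂ)) :
    heavisideTensor d φ = ∫ x, φ x * ∏ i, heaviside (x i) := by
  refine (TestFunction.integralAgainstBilinCLM_eq_integral ?_)
  exact (locallyIntegrable_heaviside d).locallyIntegrableOn _

open Classical in
/-- The net with `a_ε = 1` for `ε = 1/n`, `n ∈ ℕ`, and `a_ε = 0` otherwise. -/
def oscNet (ε : Param) : ℂ := if ∃ n : ℕ, (ε : ℝ) = 1 / n then 1 else 0

lemma oscNet_mem : oscNet ∈ numModerate :=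
  ⟨0, 1, Eventually.of_forall fun ε => by unfold oscNet; split_ifs <;> simp⟩

/-- The oscillating generalized number `a = [(a_ε)_ε]`. -/
def osc : GenNum := Ideal.Quotient.mk numNegligible ⟨oscNet, oscNet_mem⟩

end Colombeau

end

noncomputable section

namespace Colombeau

open LineDeriv

variable {d : ℕ}

/-! The examples are `w = ∂_e^k (‖x‖^s H(x_1) ⋯ H(x_d))` with `e = (1, …, 1)` and `s ≥ 0`. Their
degree is `s - k`, so every real degree occurs, and `s = k = 0` gives `H ⊗ ⋯ ⊗ H`.

Weak homogeneity: the transpose of convolution with `ρ_ε` is `smoothing`, which by the moment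
conditions moves a test function by `O(ε^m)` for every `m`, in all derivatives. Hence `∫ ι(w) φ`
equals the number `w φ` in `GenNum` (`pair_embed`), and homogeneity of `w` passes to `ι(w)` through
the test functions. Moving `w` past the integral is Fubini's theorem for a density and is stable
under differentiation (`CommutesWithIntegral`).

No strong homogeneity: by homogeneity of `w`, the blow-up `ε^{-α} ι(w)_ε(ε y)` converges to `(w *
ρ)(y)` (`tendsto_embedNet`). If `ι(w)` were homogeneous of degree `β`, so would be `w * ρ`, in the
classical pointwise sense (`eq_of_isHomogeneous_embed`). On the diagonal, `h(t) = (‖x‖^s ∏ H(x_i) *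
ρ)(t e)` is smooth, its derivatives decay rapidly as `t → -∞`, and its `k`-th derivative is `(w *
ρ)(t e)`. Homogeneity and decay make this derivative vanish for `t < 0`, hence flat at `0`, hence
zero everywhere; integrating back from `-∞` gives `h = 0` (`eq_zero_of_homogeneous_of_decay`). But
`t^{-s} h(t) → ‖e‖^s ∫ ρ ≠ 0` as `t → ∞` (`tendsto_profile`).

No associated distribution: multiplying by the oscillating constant `osc` preserves weak
homogeneity, and `osc * ι(w)` pairs with `φ` to `osc * w φ`, which has no limit when `w φ ≠ 0`. Such
a `φ` exists because `ι(w)`, not being homogeneous, is not zero. -/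

/-! ### Smoothing by an integrable kernel -/

section Smoothing

variable {F : Type} [NormedAddCommGroup F] [NormedSpace ℝ F]

/-- `g` is smooth and all its derivatives are bounded. -/
structure HasBoundedDerivs {F : Type} [NormedAddCommGroup F] [NormedSpace ℝ F]
    (g : Space d → F) : Prop where
  contDiff : ContDiff ℝ ∞ g
  bounded : ∀ i, ∃ M, ∀ z, ‖iteratedFDeriv ℝ i g z‖ ≤ M

lemma HasBoundedDerivs.fderiv {g : Space d → F} (hg : HasBoundedDerivs g) :
    HasBoundedDerivs (fderiv ℝ g) := by
  refine ⟨hg.contDiff.fderiv_right (by simp), fun i => ?_⟩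
  obtain ⟨M, hM⟩ := hg.bounded (i + 1)
  exact ⟨M, fun z => by rw [norm_iteratedFDeriv_fderiv]; exact hM z⟩

lemma HasBoundedDerivs.exists_norm_le {g : Space d → F} (hg : HasBoundedDerivs g) :
    ∃ M, ∀ z, ‖g z‖ ≤ M := by
  obtain ⟨M, hM⟩ := hg.bounded 0
  exact ⟨M, fun z => by simpa using hM z⟩

lemma HasBoundedDerivs.of_hasCompactSupport {g : Space d → F} (hg : ContDiff ℝ ∞ g)
    (hc : HasCompactSupport g) : HasBoundedDerivs g :=
  ⟨hg, fun i => Continuous.bounded_above_of_compact_support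
    (hg.continuous_iteratedFDeriv (le_inf i)) (hc.iteratedFDeriv i)⟩

lemma _root_.SchwartzMap.hasBoundedDerivs (r : 𝓢(Space d, F)) : HasBoundedDerivs r :=
  ⟨r.smooth _, fun i => ⟨_, r.norm_iteratedFDeriv_le_seminorm ℝ i⟩⟩

/-- Integral form of the remainder, with `1 / n!` and `(1 - t)^n` both bounded by `1`; only the
power of `‖h‖` matters later. -/
lemma norm_taylor_remainder_le [CompleteSpace F] {g : Space d → F} (hg : ContDiff ℝ ∞ g) {n : ℕ}
    {M : ℝ} (hM : ∀ z, ‖iteratedFDeriv ℝ (n + 1) g z‖ ≤ M) (x h : Space d) :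
    ‖g (x + h) - ∑ k ∈ Finset.range (n + 1),
      ((k.factorial : ℝ))⁻¹ • iteratedFDeriv ℝ k g x (fun _ => h)‖ ≤ M * ‖h‖ ^ (n + 1) := by
  have hM0 : 0 ≤ M := (norm_nonneg _).trans (hM x)
  rw [map_add_eq_sum_add_integral_iteratedFDeriv (n := n)
    (fun t _ => (hg.of_le (by exact_mod_cast le_top)).contDiffAt), add_sub_cancel_left, norm_smul]
  have h1 : ‖((n.factorial : ℝ))⁻¹‖ ≤ 1 := by
    rw [norm_inv, Real.norm_natCast]
    exact inv_le_one_of_one_le₀ (by exact_mod_cast n.factorial_pos)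
  have h2 := intervalIntegral.norm_integral_le_of_norm_le_const (a := 0) (b := 1)
    (C := M * ‖h‖ ^ (n + 1))
    (f := fun t : ℝ => (1 - t) ^ n • iteratedFDeriv ℝ (n + 1) g (x + t • h) (fun _ => h))
    (fun t ht => by
      rw [Set.uIoc_of_le zero_le_one] at ht
      rw [norm_smul, norm_pow, Real.norm_eq_abs, abs_of_nonneg (by linarith [ht.2])]
      have h3 := (iteratedFDeriv ℝ (n + 1) g (x + t • h)).le_opNorm (fun _ => h)
      rw [Finset.prod_const, Finset.card_fin] at h3
      calc (1 - t) ^ n * _ ≤ 1 * (M * ‖h‖ ^ (n + 1)) :=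
            mul_le_mul (pow_le_one₀ (by linarith [ht.2]) (by linarith [ht.1]))
              (h3.trans (mul_le_mul_of_nonneg_right (hM _) (by positivity))) (norm_nonneg _)
              zero_le_one
        _ = _ := one_mul _)
  rw [sub_zero, abs_one, mul_one] at h2
  calc _ ≤ 1 * (M * ‖h‖ ^ (n + 1)) := mul_le_mul h1 h2 (norm_nonneg _) zero_le_one
    _ = _ := one_mul _

variable [NormedSpace ℂ F]

/-- The function `y ↦ ∫ κ(t) g(y + t) dt`. -/
def smoothing (κ : Space d → ℂ) (g : Space d → F) (y : Space d) : F := ∫ t, κ t • g (y + t)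

lemma integrable_smul_shift {κ : Space d → ℂ} (hκ : Integrable κ) {g : Space d → F}
    (hg : HasBoundedDerivs g) (y : Space d) : Integrable fun t => κ t • g (y + t) := by
  obtain ⟨M, hM⟩ := hg.exists_norm_le
  exact hκ.smul_bdd M (hg.contDiff.continuous.comp (continuous_const_add y)).aestronglyMeasurable
    (Eventually.of_forall fun t => hM _)

lemma hasFDerivAt_smoothing [IsScalarTower ℝ ℂ F] {κ : Space d → ℂ} (hκ : Integrable κ)
    {g : Space d → F} (hg : HasBoundedDerivs g) (y : Space d) :
    HasFDerivAt (smoothing κ g) (smoothing κ (fderiv ℝ g) y) y := by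
  obtain ⟨M, hM⟩ := hg.fderiv.exists_norm_le
  refine hasFDerivAt_integral_of_dominated_of_fderiv_le (𝕜 := ℝ) (s := Set.univ)
    (F' := fun y t => κ t • fderiv ℝ g (y + t)) (bound := fun t => ‖κ t‖ * M) univ_mem
    (Eventually.of_forall fun y => (integrable_smul_shift hκ hg y).aestronglyMeasurable)
    (integrable_smul_shift hκ hg y)
    (integrable_smul_shift hκ hg.fderiv y).aestronglyMeasurable
    (Eventually.of_forall fun t x _ => ?_) (hκ.norm.mul_const M)
    (Eventually.of_forall fun t x _ => ?_)
  · rw [norm_smul]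
    exact mul_le_mul_of_nonneg_left (hM _) (norm_nonneg _)
  · have h : HasFDerivAt (fun x => g (x + t)) (fderiv ℝ g (x + t)) x :=
      (hg.contDiff.differentiable (by simp) (x + t)).hasFDerivAt.comp x
        ((hasFDerivAt_id x).add_const t)
    exact h.const_smul (κ t)

/-- The target space is quantified inside the induction because the step replaces `g` by `fderiv ℝ
g`, which takes values in a space of linear maps. -/
lemma contDiff_smoothing_nat {κ : Space d → ℂ} (hκ : Integrable κ) (n : ℕ) :
    ∀ {F : Type} [NormedAddCommGroup F] [NormedSpace ℝ F] [NormedSpace ℂ F] [IsScalarTower ℝ ℂ F]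
      {g : Space d → F}, HasBoundedDerivs g → ContDiff ℝ n (smoothing κ g) := by
  induction n with
  | zero =>
    intro F _ _ _ _ g hg
    exact contDiff_zero.2 (continuous_iff_continuousAt.2 fun y =>
      (hasFDerivAt_smoothing hκ hg y).continuousAt)
  | succ n ih =>
    intro F _ _ _ _ g hg
    push_cast
    refine contDiff_succ_iff_fderiv.2 ⟨fun y => (hasFDerivAt_smoothing hκ hg y).differentiableAt,
      fun h => absurd h (by simp), ?_⟩
    rw [show fderiv ℝ (smoothing κ g) = smoothing κ (fderiv ℝ g) from
      funext fun y => (hasFDerivAt_smoothing hκ hg y).fderiv]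
    exact ih hg.fderiv

lemma contDiff_smoothing [IsScalarTower ℝ ℂ F] {κ : Space d → ℂ} (hκ : Integrable κ)
    {g : Space d → F} (hg : HasBoundedDerivs g) : ContDiff ℝ ∞ (smoothing κ g) :=
  contDiff_infty.2 fun n => contDiff_smoothing_nat hκ n hg

/-! ### Rate of convergence of the mollification -/

/-- Expanding `t` in the standard basis turns `T(t, …, t)` into a sum over `σ : Fin j → Fin d` of
monomials with exponents `β i = #σ⁻¹(i)`. Their total degree is `j ≠ 0`, so each moment vanishes. -/
lemma Mollifier.integral_smul_multilinear [IsScalarTower ℝ ℂ F] [CompleteSpace F]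
    (ρ : Mollifier d) {j : ℕ} (hj : j ≠ 0) (T : Space d [×j]→L[ℝ] F) :
    Integrable (fun t => ρ.ρ t • T fun _ => t) ∧ ∫ t, ρ.ρ t • T (fun _ => t) = 0 := by
  classical
  have hT : ∀ t : Space d, T (fun _ => t) = ∑ σ : Fin j → Fin d,
      (∏ i, (((t i : ℝ) : ℂ)) ^ (Finset.univ.filter fun a => σ a = i).card) •
        T fun a => EuclideanSpace.single (σ a) (1 : ℝ) := by
    intro t
    have ht : t = ∑ i, t i • EuclideanSpace.single i (1 : ℝ) := by
      have := (EuclideanSpace.basisFun (Fin d) ℝ).sum_repr t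
      simpa using this.symm
    conv_lhs => rw [ht]
    rw [T.map_sum (fun _ i => t i • EuclideanSpace.single i (1 : ℝ))]
    refine Finset.sum_congr rfl fun σ _ => ?_
    rw [T.map_smul_univ]
    have : ∏ i, (((t i : ℝ) : ℂ)) ^ (Finset.univ.filter fun a => σ a = i).card =
        ((∏ a, t (σ a) : ℝ) : ℂ) := by
      push_cast
      rw [← Finset.prod_fiberwise_of_maps_to (g := σ) (fun a _ => Finset.mem_univ (σ a))]
      refine Finset.prod_congr rfl fun i _ => ?_
      rw [Finset.prod_congr rfl (g := fun _ => ((t i : ℝ) : ℂ))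
        (fun a ha => by rw [(Finset.mem_filter.1 ha).2]), Finset.prod_const]
    rw [this, ← algebraMap_smul ℂ (∏ a, t (σ a))]
    rfl
  have hint : ∀ β : Fin d → ℕ, Integrable fun t : Space d =>
      (∏ i, (((t i : ℝ) : ℂ)) ^ β i) * ρ.ρ t := by
    intro β
    refine (ρ.ρ.integrable_pow_mul volume (∑ i, β i)).mono' ?_ (Eventually.of_forall fun t => ?_)
    · exact Continuous.aestronglyMeasurable (by fun_prop)
    · rw [norm_mul, norm_prod, ← Finset.prod_pow_eq_pow_sum]
      refine mul_le_mul_of_nonneg_right ?_ (norm_nonneg _)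
      refine Finset.prod_le_prod (fun i _ => norm_nonneg _) fun i _ => ?_
      rw [norm_pow, Complex.norm_real]
      exact pow_le_pow_left₀ (norm_nonneg _) (PiLp.norm_apply_le t i) _
  have hrw : (fun t => ρ.ρ t • T fun _ => t) = fun t => ∑ σ : Fin j → Fin d,
      ((∏ i, (((t i : ℝ) : ℂ)) ^ (Finset.univ.filter fun a => σ a = i).card) * ρ.ρ t) •
        T fun a => EuclideanSpace.single (σ a) (1 : ℝ) := by
    funext t
    rw [hT, Finset.smul_sum]
    exact Finset.sum_congr rfl fun σ _ => by rw [smul_smul, mul_comm]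
  rw [hrw]
  refine ⟨integrable_finsetSum _ fun σ _ => (hint _).smul_const _, ?_⟩
  rw [integral_finsetSum _ fun σ _ => (hint _).smul_const _]
  refine Finset.sum_eq_zero fun σ _ => ?_
  rw [integral_smul_const, ρ.moments, zero_smul]
  intro h
  have := congr_fun h (σ ⟨0, Nat.pos_of_ne_zero hj⟩)
  simp only [Pi.zero_apply, Finset.card_eq_zero, Finset.filter_eq_empty_iff] at this
  exact this (Finset.mem_univ _) rfl

lemma Mollifier.smoothing_scaled (ρ : Mollifier d) [IsScalarTower ℝ ℂ F] (ε : Param)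
    (g : Space d → F) (y : Space d) :
    smoothing (ρ.scaled ε) g y = ∫ t, ρ.ρ t • g (y + (ε : ℝ) • t) := by
  have hε : (ε : ℝ) ≠ 0 := ε.2.1.ne'
  have := Measure.integral_comp_inv_smul (μ := (volume : Measure (Space d)))
    (fun t => ρ.ρ t • g (y + (ε : ℝ) • t)) (ε : ℝ)
  rw [finrank_euclideanSpace_fin, abs_of_nonneg (pow_nonneg ε.2.1.le d)] at this
  rw [← inv_smul_smul₀ (pow_ne_zero d hε) (∫ t, ρ.ρ t • g (y + (ε : ℝ) • t)), ← this,
    ← integral_smul]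
  refine integral_congr_ae (Eventually.of_forall fun t => ?_)
  simp only [smul_inv_smul₀ hε, Mollifier.scaled, mul_smul]
  rw [← algebraMap_smul ℂ ((ε : ℝ) ^ d)⁻¹]
  rfl

lemma Mollifier.integrable_scaled (ρ : Mollifier d) (ε : Param) : Integrable (ρ.scaled ε) :=
  (ρ.ρ.integrable.comp_smul (inv_ne_zero ε.2.1.ne')).const_mul _

/-- After rescaling, Taylor's formula is integrated against `ρ`: the constant term gives `g y` since
`∫ ρ = 1`, the higher terms vanish by the moment conditions, and the remainder is at most `M ε^(n+1)
‖t‖^(n+1)`, integrable against a Schwartz function. -/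
lemma norm_smoothing_sub_le [IsScalarTower ℝ ℂ F] [CompleteSpace F] (ρ : Mollifier d)
    {g : Space d → F} (hg : HasBoundedDerivs g) (n : ℕ) :
    ∃ C, ∀ (ε : Param) y, ‖smoothing (ρ.scaled ε) g y - g y‖ ≤ C * (ε : ℝ) ^ n := by
  obtain ⟨M, hM⟩ := hg.bounded (n + 1)
  have hM0 : 0 ≤ M := (norm_nonneg _).trans (hM 0)
  refine ⟨∫ t, M * (‖t‖ ^ (n + 1) * ‖ρ.ρ t‖), fun ε y => ?_⟩
  have hT : ∀ k : ℕ, Integrable (fun t => ρ.ρ t • (((k.factorial : ℝ))⁻¹ •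
        iteratedFDeriv ℝ k g y (fun _ => (ε : ℝ) • t))) ∧
      ∫ t, ρ.ρ t • (((k.factorial : ℝ))⁻¹ • iteratedFDeriv ℝ k g y (fun _ => (ε : ℝ) • t)) =
        if k = 0 then g y else 0 := by
    intro k
    have e : (fun t => ρ.ρ t • (((k.factorial : ℝ))⁻¹ •
        iteratedFDeriv ℝ k g y (fun _ => (ε : ℝ) • t))) =
        fun t => ρ.ρ t • ((((k.factorial : ℝ))⁻¹ * (ε : ℝ) ^ k) • iteratedFDeriv ℝ k g y)
          (fun _ => t) := by
      funext t
      have := (iteratedFDeriv ℝ k g y).map_smul_univ (fun _ => (ε : ℝ)) (fun _ => t)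
      rw [Finset.prod_const, Finset.card_fin] at this
      rw [this, smul_smul]
      rfl
    rw [e]
    split_ifs with hk
    · subst hk
      refine ⟨by simpa using ρ.ρ.integrable.smul_const (g y), ?_⟩
      simp [integral_smul_const, ρ.integral_eq_one]
    · exact ρ.integral_smul_multilinear hk _
  have hI := integrable_finsetSum (Finset.range (n + 1)) fun k _ => (hT k).1
  have hg' : Integrable fun t => ρ.ρ t • g (y + (ε : ℝ) • t) := by
    obtain ⟨B, hB⟩ := hg.exists_norm_le
    exact ρ.ρ.integrable.smul_bdd B
      (hg.contDiff.continuous.comp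
        (by fun_prop : Continuous fun t : Space d => y + (ε : ℝ) • t)).aestronglyMeasurable
      (Eventually.of_forall fun t => hB _)
  have h1 : g y = ∫ t, ∑ k ∈ Finset.range (n + 1), ρ.ρ t • (((k.factorial : ℝ))⁻¹ •
      iteratedFDeriv ℝ k g y (fun _ => (ε : ℝ) • t)) := by
    rw [integral_finsetSum _ fun k _ => (hT k).1, Finset.sum_congr rfl fun k _ => (hT k).2]
    simp
  rw [ρ.smoothing_scaled]
  conv_lhs => rw [h1]
  rw [← integral_sub hg' hI, ← integral_mul_const]
  refine norm_integral_le_of_norm_le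
    (((ρ.ρ.integrable_pow_mul volume (n + 1)).const_mul M).mul_const _)
    (Eventually.of_forall fun t => ?_)
  rw [← Finset.smul_sum, ← smul_sub, norm_smul]
  have h2 := norm_taylor_remainder_le hg.contDiff hM y ((ε : ℝ) • t)
  rw [norm_smul, Real.norm_of_nonneg ε.2.1.le, mul_pow] at h2
  have h3 : (ε : ℝ) ^ (n + 1) ≤ (ε : ℝ) ^ n :=
    pow_le_pow_of_le_one ε.2.1.le ε.2.2 (Nat.le_succ n)
  calc ‖ρ.ρ t‖ * _ ≤ ‖ρ.ρ t‖ * (M * ((ε : ℝ) ^ n * ‖t‖ ^ (n + 1))) := by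
        refine mul_le_mul_of_nonneg_left (h2.trans ?_) (norm_nonneg _)
        gcongr
    _ = _ := by ring

/-- Smoothing commutes with `fderiv`, so each derivative of the error is the error for a derivative
of `g`. -/
lemma norm_iteratedFDeriv_smoothing_sub_le (ρ : Mollifier d) (n i : ℕ) :
    ∀ {F : Type} [NormedAddCommGroup F] [NormedSpace ℝ F] [NormedSpace ℂ F] [IsScalarTower ℝ ℂ F]
      [CompleteSpace F] {g : Space d → F}, HasBoundedDerivs g →
    ∃ C, ∀ (ε : Param) y,
      ‖iteratedFDeriv ℝ i (fun y => smoothing (ρ.scaled ε) g y - g y) y‖ ≤ C * (ε : ℝ) ^ n := by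
  induction i with
  | zero =>
    intro F _ _ _ _ _ g hg
    obtain ⟨C, hC⟩ := norm_smoothing_sub_le ρ hg n
    exact ⟨C, fun ε y => by rw [norm_iteratedFDeriv_zero]; exact hC ε y⟩
  | succ i ih =>
    intro F _ _ _ _ _ g hg
    obtain ⟨C, hC⟩ := ih hg.fderiv
    refine ⟨C, fun ε y => ?_⟩
    rw [← norm_iteratedFDeriv_fderiv]
    rw [show fderiv ℝ (fun y => smoothing (ρ.scaled ε) g y - g y) =
      fun y => smoothing (ρ.scaled ε) (fderiv ℝ g) y - fderiv ℝ g y from funext fun y =>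
        ((hasFDerivAt_smoothing (ρ.integrable_scaled ε) hg y).sub
          (hg.contDiff.differentiable (by simp) y).hasFDerivAt).fderiv]
    exact hC ε y

end Smoothing

/-! ### Derivatives of distributions -/

lemma lineDerivOp_testFunction_apply {F : Type} [NormedAddCommGroup F] [NormedSpace ℝ F]
    (v : Space d) (φ : 𝓓((⊤ : TopologicalSpace.Opens (Space d)), F)) (x : Space d) :
    (∂_{v} φ : 𝓓((⊤ : TopologicalSpace.Opens (Space d)), F)) x = fderiv ℝ φ x v := by
  rw [TestFunction.lineDerivOp_eq_lineDerivCLM ℝ, TestFunction.lineDerivCLM_eq_fderivCLM,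
    TestFunction.fderivCLM_apply_of_le _ (by exact le_top)]

/-- The derivative of a distribution in the direction `v`. -/
def Dist.lineDeriv (w : Dist d) (v : Space d) : Dist d :=
  -(w.comp (TestFunction.lineDerivCLM ℂ v))

lemma Dist.lineDeriv_apply (w : Dist d) (v : Space d)
    (φ : 𝓓((⊤ : TopologicalSpace.Opens (Space d)), ℂ)) : w.lineDeriv v φ = -w (∂_{v} φ) := rfl

lemma lineDerivOp_cutTest (v : Space d) (ψ : 𝓓((⊤ : TopologicalSpace.Opens (Space d)), ℝ))
    {g : Space d → ℂ} (hg : ContDiff ℝ ∞ g) :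
    ∂_{v} (cutTest ψ g hg) = cutTest (∂_{v} ψ) g hg +
      cutTest ψ (fun y => fderiv ℝ g y v) (contDiff_dirDeriv hg v) := by
  ext y
  rw [lineDerivOp_testFunction_apply]
  change fderiv ℝ (fun y => ψ y • g y) y v =
    (∂_{v} ψ : 𝓓((⊤ : TopologicalSpace.Opens (Space d)), ℝ)) y • g y + ψ y • fderiv ℝ g y v
  rw [fderiv_fun_smul (ψ.contDiff.differentiable (by simp) y) (hg.differentiable (by simp) y),
    lineDerivOp_testFunction_apply, add_comm]
  rfl

lemma cutTest_congr (ψ : 𝓓((⊤ : TopologicalSpace.Opens (Space d)), ℝ))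
    {f g : Space d → ℂ} (hf : ContDiff ℝ ∞ f) (hg : ContDiff ℝ ∞ g) (h : ∀ y, f y = g y) :
    cutTest ψ f hf = cutTest ψ g hg := by
  ext y
  change ψ y • f y = ψ y • g y
  rw [h]

lemma cutTest_neg (ψ : 𝓓((⊤ : TopologicalSpace.Opens (Space d)), ℝ))
    {f g : Space d → ℂ} (hf : ContDiff ℝ ∞ f) (hg : ContDiff ℝ ∞ g) (h : ∀ y, f y = -g y) :
    cutTest ψ f hf = -cutTest ψ g hg := by
  ext y
  change ψ y • f y = -(ψ y • g y)
  rw [h, smul_neg]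

/-- The regular distribution with density `f`. -/
def regular (f : Space d → ℂ) : Dist d :=
  TestFunction.integralAgainstBilinCLM (ContinuousLinearMap.mul ℂ ℂ) volume f

lemma regular_apply {f : Space d → ℂ} (hf : LocallyIntegrable f)
    (φ : 𝓓((⊤ : TopologicalSpace.Opens (Space d)), ℂ)) : regular f φ = ∫ x, φ x * f x :=
  TestFunction.integralAgainstBilinCLM_eq_integral (hf.locallyIntegrableOn _)

/-! ### Exchanging a distribution with an integral -/

lemma hasBoundedDerivs_testFunction {F : Type} [NormedAddCommGroup F] [NormedSpace ℝ F]
    (φ : 𝓓((⊤ : TopologicalSpace.Opens (Space d)), F)) : HasBoundedDerivs φ :=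
  .of_hasCompactSupport φ.contDiff φ.hasCompactSupport

lemma contDiff_smoothing_test (r : 𝓢(Space d, ℂ))
    (g : 𝓓((⊤ : TopologicalSpace.Opens (Space d)), ℂ)) : ContDiff ℝ ∞ (smoothing r g) :=
  contDiff_smoothing r.integrable (hasBoundedDerivs_testFunction g)

lemma smoothing_eq_integral_sub (κ g : Space d → ℂ) (y : Space d) :
    smoothing κ g y = ∫ x, g x * κ (x - y) := by
  rw [← integral_add_left_eq_self (fun x => g x * κ (x - y)) y]
  simp [smoothing, mul_comm]

/-- Integration by parts moves the derivative from `g` to the kernel. This matches the derivative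
that falls on `r` when a differentiated distribution is applied to `ψ(y) r(x - y)`. -/
lemma fderiv_smoothing_test (r : 𝓢(Space d, ℂ))
    (g : 𝓓((⊤ : TopologicalSpace.Opens (Space d)), ℂ)) (v y : Space d) :
    fderiv ℝ (smoothing r g) y v = -smoothing (∂_{v} r : 𝓢(Space d, ℂ)) g y := by
  have hg := hasBoundedDerivs_testFunction g
  rw [(hasFDerivAt_smoothing r.integrable hg y).fderiv]
  unfold smoothing
  rw [ContinuousLinearMap.integral_apply (integrable_smul_shift r.integrable hg.fderiv y)]
  simp only [smul_apply, smul_eq_mul, SchwartzMap.lineDerivOp_apply_eq_fderiv]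
  have hfd : ∀ t, fderiv ℝ (fun t => g (y + t)) t = fderiv ℝ g (y + t) :=
    fun t => fderiv_comp_add_left y
  have := integral_mul_fderiv_eq_neg_fderiv_mul_of_integrable (μ := (volume : Measure (Space d)))
    (f := r) (g := fun t => g (y + t)) (v := v) ?_ ?_ ?_ (fun t _ => r.differentiable t)
    (fun t _ => ((hg.contDiff.differentiable (by simp)).comp
      (by fun_prop : Differentiable ℝ fun t : Space d => y + t)) t)
  · simpa only [hfd] using this
  · have := integrable_smul_shift (∂_{v} r : 𝓢(Space d, ℂ)).integrable hg y
    simpa only [smul_eq_mul, SchwartzMap.lineDerivOp_apply_eq_fderiv] using this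
  · simp only [hfd]
    simpa using (integrable_smul_shift r.integrable hg.fderiv y).apply_continuousLinearMap v
  · exact integrable_smul_shift r.integrable hg y

/-- The distribution `w` may be exchanged with integration against test functions. -/
def Dist.CommutesWithIntegral (w : Dist d) : Prop :=
  ∀ (ψ : 𝓓((⊤ : TopologicalSpace.Opens (Space d)), ℝ)) (r : 𝓢(Space d, ℂ))
    (g : 𝓓((⊤ : TopologicalSpace.Opens (Space d)), ℂ)),
    ∫ x, g x * cutConv w ψ r (r.smooth _) x =
      w (cutTest ψ (smoothing r g) (contDiff_smoothing_test r g))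

/-- Fubini: `g` and `ψ f` are integrable and `r` is bounded, so the double integral converges
absolutely. -/
lemma commutesWithIntegral_regular {f : Space d → ℂ} (hf : LocallyIntegrable f) :
    (regular f).CommutesWithIntegral := by
  intro ψ r g
  obtain ⟨M, hM⟩ := r.hasBoundedDerivs.exists_norm_le
  have hψ : Integrable fun z => (ψ z : ℂ) * f z := by
    simpa using hf.integrable_smul_left_of_hasCompactSupport ψ.continuous ψ.hasCompactSupport
  have hg : Integrable g := g.continuous.integrable_of_hasCompactSupport g.hasCompactSupport
  have hI : Integrable (Function.uncurry fun x z => g x * (ψ z * f z) * r (x - z))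
      (volume.prod volume) :=
    (hg.mul_prod hψ).mul_bdd (c := M)
      (r.continuous.comp (continuous_fst.sub continuous_snd)).aestronglyMeasurable
      (Eventually.of_forall fun p => hM _)
  rw [regular_apply hf]
  calc ∫ x, g x * cutConv (regular f) ψ r (r.smooth _) x
      = ∫ x, ∫ z, g x * (ψ z * f z) * r (x - z) := by
        refine integral_congr_ae (Eventually.of_forall fun x => ?_)
        change g x * regular f _ = _
        rw [regular_apply hf, ← integral_const_mul]
        refine integral_congr_ae (Eventually.of_forall fun z => ?_)
        change g x * ((ψ z • r (x - z)) * f z) = _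
        rw [Complex.real_smul]
        ring
    _ = ∫ z, ∫ x, g x * (ψ z * f z) * r (x - z) := integral_integral_swap hI
    _ = _ := by
        refine integral_congr_ae (Eventually.of_forall fun z => ?_)
        change _ = (ψ z • smoothing r g z) * f z
        rw [smoothing_eq_integral_sub, Complex.real_smul, mul_right_comm, ← integral_const_mul]
        refine integral_congr_ae (Eventually.of_forall fun x => ?_)
        ring

lemma continuous_cutConv (w : Dist d) (ψ : 𝓓((⊤ : TopologicalSpace.Opens (Space d)), ℝ))
    (r : 𝓢(Space d, ℂ)) : Continuous (cutConv w ψ r (r.smooth _)) :=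
  continuous_iff_continuousAt.2 fun x => by
    obtain ⟨L, hL, -⟩ := hasFDerivAt_cutConv w ψ (r.smooth _) r.hasBoundedDerivs.bounded x
    exact hL.continuousAt

/-- By the Leibniz rule the derivative falls either on `ψ` or on `r`. Both terms are instances of
the property for `w`, since it is required for all cut-offs and all Schwartz kernels. -/
lemma Dist.CommutesWithIntegral.lineDeriv {w : Dist d} (hw : w.CommutesWithIntegral)
    (v : Space d) : (w.lineDeriv v).CommutesWithIntegral := by
  intro ψ r g
  have h1 : ∀ x, cutConv (w.lineDeriv v) ψ r (r.smooth _) x =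
      cutConv w ψ (∂_{v} r : 𝓢(Space d, ℂ)) (SchwartzMap.smooth _ _) x -
        cutConv w (∂_{v} ψ) r (r.smooth _) x := by
    intro x
    unfold cutConv
    rw [Dist.lineDeriv_apply, lineDerivOp_cutTest,
      cutTest_neg ψ _ (g := fun y => (∂_{v} r : 𝓢(Space d, ℂ)) (x - y))
        ((SchwartzMap.smooth _ _).comp (contDiff_const.sub contDiff_id)), map_add, map_neg]
    · ring
    · intro y
      rw [SchwartzMap.lineDerivOp_apply_eq_fderiv]
      have h : HasFDerivAt (fun y => r (x - y))
          ((_root_.fderiv ℝ r (x - y)).comp (-(ContinuousLinearMap.id ℝ (Space d)))) y :=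
        (r.differentiable (x - y)).hasFDerivAt.comp y ((hasFDerivAt_id y).const_sub x)
      rw [h.fderiv]
      simp
  have hint : ∀ (ψ : 𝓓((⊤ : TopologicalSpace.Opens (Space d)), ℝ)) (r : 𝓢(Space d, ℂ)),
      Integrable fun x => g x * cutConv w ψ r (r.smooth _) x := fun ψ r =>
    (g.continuous.mul (continuous_cutConv w ψ r)).integrable_of_hasCompactSupport
      g.hasCompactSupport.mul_right
  simp only [h1, mul_sub]
  rw [integral_sub (hint _ _) (hint _ _), hw, hw, Dist.lineDeriv_apply, lineDerivOp_cutTest,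
    cutTest_neg ψ _ (contDiff_smoothing_test _ g) (fderiv_smoothing_test r g v), map_add, map_neg]
  ring

/-! ### Homogeneity of derivatives -/

lemma lineDerivOp_dilate (c : ℝ) (hc : 0 < c) (v : Space d)
    (φ : 𝓓((⊤ : TopologicalSpace.Opens (Space d)), ℂ)) :
    ∂_{v} (dilate c hc φ) = ((c⁻¹ : ℝ) : ℂ) • dilate c hc (∂_{v} φ) := by
  ext x
  rw [lineDerivOp_testFunction_apply]
  change fderiv ℝ (fun x => (((c ^ d)⁻¹ : ℝ) : ℂ) * φ (c⁻¹ • x)) x v =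
    ((c⁻¹ : ℝ) : ℂ) * ((((c ^ d)⁻¹ : ℝ) : ℂ) *
      (∂_{v} φ : 𝓓((⊤ : TopologicalSpace.Opens (Space d)), ℂ)) (c⁻¹ • x))
  rw [lineDerivOp_testFunction_apply]
  have h : HasFDerivAt (fun x => φ (c⁻¹ • x))
      ((fderiv ℝ φ (c⁻¹ • x)).comp (c⁻¹ • ContinuousLinearMap.id ℝ (Space d))) x :=
    (φ.contDiff.differentiable (by simp) (c⁻¹ • x)).hasFDerivAt.comp x
      ((hasFDerivAt_id x).const_smul c⁻¹)
  rw [(h.const_mul _).fderiv]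
  simp
  ring

lemma Dist.IsHomogeneous.lineDeriv {w : Dist d} {α : ℝ} (hw : w.IsHomogeneous α) (v : Space d) :
    (w.lineDeriv v).IsHomogeneous (α - 1) := by
  intro c hc φ
  rw [Dist.lineDeriv_apply, Dist.lineDeriv_apply, lineDerivOp_dilate, map_smul, hw, smul_eq_mul,
    Real.rpow_sub hc, Real.rpow_one]
  push_cast
  ring

lemma isHomogeneous_regular {f : Space d → ℂ} (hf : LocallyIntegrable f) {α : ℝ}
    (h : ∀ c : ℝ, 0 < c → ∀ x, f (c • x) = ((c ^ α : ℝ) : ℂ) * f x) :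
    (regular f).IsHomogeneous α := by
  intro c hc φ
  rw [regular_apply hf, regular_apply hf]
  have h1 := Measure.integral_comp_inv_smul (μ := (volume : Measure (Space d)))
    (fun x => φ x * f (c • x)) c
  rw [finrank_euclideanSpace_fin, abs_of_nonneg (pow_nonneg hc.le d)] at h1
  simp only [smul_inv_smul₀ hc.ne'] at h1
  calc ∫ x, dilate c hc φ x * f x = ∫ x, (((c ^ d)⁻¹ : ℝ) : ℂ) * (φ (c⁻¹ • x) * f x) := by
        refine integral_congr_ae (Eventually.of_forall fun x => ?_)
        exact mul_assoc _ _ _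
    _ = ∫ x, φ x * f (c • x) := by
        rw [integral_const_mul, h1, Complex.real_smul, ← mul_assoc, ← Complex.ofReal_mul,
          inv_mul_cancel₀ (pow_ne_zero d hc.ne'), Complex.ofReal_one, one_mul]
    _ = _ := by
        rw [← integral_const_mul]
        refine integral_congr_ae (Eventually.of_forall fun x => ?_)
        simp only [h c hc]
        ring

/-! ### The embedding and the pairing with test functions -/

/-- `ρ_ε` as a Schwartz function. -/
def Mollifier.scaledSchwartz (ρ : Mollifier d) (ε : Param) : 𝓢(Space d, ℂ) :=
  ((((ε : ℝ) ^ d)⁻¹ : ℝ) : ℂ) • SchwartzMap.compCLMOfContinuousLinearEquiv ℂ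
    (ContinuousLinearEquiv.smulLeft (Units.mk0 ((ε : ℝ)⁻¹) (inv_ne_zero ε.2.1.ne'))) ρ.ρ

lemma CutoffSystem.exists_finset (P : CutoffSystem d) {K : Set (Space d)} (hK : IsCompact K) :
    ∃ S : Finset ℕ, ∀ x ∈ K, ∀ j, j ∉ S → P.χ j x = 0 := by
  have hfin := P.locallyFinite.finite_nonempty_inter_compact hK
  refine ⟨hfin.toFinset, fun x hx j hj => ?_⟩
  by_contra h
  exact hj (hfin.mem_toFinset.2 ⟨x, h, hx⟩)

lemma CutoffSystem.sum_eq_one_of_forall (P : CutoffSystem d) {S : Finset ℕ} {x : Space d}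
    (hS : ∀ j, j ∉ S → P.χ j x = 0) : ∑ j ∈ S, P.χ j x = 1 := by
  rw [← P.sum_eq_one x]
  refine (finsum_eq_sum_of_support_subset _ fun j hj => ?_).symm
  by_contra h
  exact hj (hS j h)

lemma embedNet_eq_sum (ρ : Mollifier d) (P : CutoffSystem d) (w : Dist d) (ε : Param)
    {S : Finset ℕ} {x : Space d} (hS : ∀ j, j ∉ S → P.χ j x = 0) :
    embedNet ρ P w ε x = ∑ j ∈ S, (P.χ j x : ℂ) *
      cutConv w (P.ψ j) (ρ.scaled ε) (ρ.contDiff_scaled ε) x := by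
  refine finsum_eq_sum_of_support_subset _ fun j hj => ?_
  by_contra h
  exact hj (by simp [hS j h])

lemma CutoffSystem.ψ_mul_χ (P : CutoffSystem d) (j : ℕ) (x : Space d) :
    P.ψ j x * P.χ j x = P.χ j x := by
  by_cases hx : x ∈ tsupport (P.χ j)
  · rw [(P.cutoff j).self_of_nhdsSet x hx, one_mul]
  · rw [image_eq_zero_of_notMem_tsupport hx, mul_zero]

/-- Once `w` is moved outside the integral and `g` is written as `ψ g`, the difference is `w`
applied to `ψ` times the smoothing error, which is `O(ε^m)` in the finitely many derivatives that
control `w`. -/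
lemma Dist.CommutesWithIntegral.cutConv_bound {w : Dist d} (hw : w.CommutesWithIntegral)
    (ρ : Mollifier d) (ψ : 𝓓((⊤ : TopologicalSpace.Opens (Space d)), ℝ))
    (g : 𝓓((⊤ : TopologicalSpace.Opens (Space d)), ℂ)) (hψ : ∀ x, ψ x • g x = g x) (m : ℕ) :
    ∃ C, ∀ ε : Param,
      ‖(∫ x, g x * cutConv w ψ (ρ.scaled ε) (ρ.contDiff_scaled ε) x) - w g‖ ≤ C * (ε : ℝ) ^ m := by
  obtain ⟨n, C, hC, hwC⟩ := exists_cutTest_bound w ψ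
  choose B hB using fun i =>
    norm_iteratedFDeriv_smoothing_sub_le ρ m i (hasBoundedDerivs_testFunction g)
  refine ⟨C * ∑ i ∈ Finset.range (n + 1), |B i|, fun ε => ?_⟩
  have h1 : (∫ x, g x * cutConv w ψ (ρ.scaled ε) (ρ.contDiff_scaled ε) x) =
      w (cutTest ψ (smoothing (ρ.scaled ε) g) (contDiff_smoothing_test (ρ.scaledSchwartz ε) g)) :=
    hw ψ (ρ.scaledSchwartz ε) g
  have h2 : w g = w (cutTest ψ g g.contDiff) := by
    congr 1
    ext x
    exact (hψ x).symm
  have h3 : ContDiff ℝ ∞ fun y => smoothing (ρ.scaled ε) g y - g y :=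
    (contDiff_smoothing_test (ρ.scaledSchwartz ε) g).sub g.contDiff
  have h4 : cutTest ψ (smoothing (ρ.scaled ε) g)
      (contDiff_smoothing_test (ρ.scaledSchwartz ε) g) - cutTest ψ g g.contDiff =
      cutTest ψ (fun y => smoothing (ρ.scaled ε) g y - g y) h3 := by
    ext y
    exact (smul_sub _ _ _).symm
  rw [h1, h2, ← map_sub, h4, mul_assoc]
  refine hwC _ _ _ fun i hi y => (hB i ε y).trans ?_
  refine mul_le_mul_of_nonneg_right ((le_abs_self _).trans ?_) (pow_nonneg ε.2.1.le m)
  exact Finset.single_le_sum (f := fun i => |B i|) (fun i _ => abs_nonneg _)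
    (Finset.mem_range.2 (by omega))

/-- An equality of generalized numbers, stronger than association. The test function is split as `∑
χ_j φ`, a finite sum on its support, and `ψ_j χ_j = χ_j` makes each cut-off invisible. -/
lemma Dist.CommutesWithIntegral.pair_embed {w : Dist d} (hw : w.CommutesWithIntegral)
    (ρ : Mollifier d) (P : CutoffSystem d)
    (φ : 𝓓((⊤ : TopologicalSpace.Opens (Space d)), ℂ)) :
    Gen.pair φ (embed ρ P w) = algebraMap ℂ GenNum (w φ) := by
  obtain ⟨S, hS⟩ := P.exists_finset φ.hasCompactSupport
  have hg : ∀ j x, P.ψ j x • cutTest (P.χ j) φ φ.contDiff x = cutTest (P.χ j) φ φ.contDiff x := by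
    intro j x
    change P.ψ j x • P.χ j x • φ x = P.χ j x • φ x
    rw [smul_smul, P.ψ_mul_χ]
  have hsum : ∑ j ∈ S, w (cutTest (P.χ j) φ φ.contDiff) = w φ := by
    rw [← map_sum]
    congr 1
    ext x
    rw [sum_apply]
    change ∑ j ∈ S, P.χ j x • φ x = φ x
    rw [← Finset.sum_smul]
    by_cases hx : x ∈ tsupport φ
    · rw [P.sum_eq_one_of_forall (hS x hx), one_smul]
    · rw [image_eq_zero_of_notMem_tsupport hx, smul_zero]
  have hpair : ∀ ε, ∫ x, embedNet ρ P w ε x * φ x = ∑ j ∈ S,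
      ∫ x, cutTest (P.χ j) φ φ.contDiff x *
        cutConv w (P.ψ j) (ρ.scaled ε) (ρ.contDiff_scaled ε) x := by
    intro ε
    rw [← integral_finsetSum]
    · refine integral_congr_ae (Eventually.of_forall fun x => ?_)
      change embedNet ρ P w ε x * φ x = ∑ j ∈ S, (P.χ j x • φ x) * _
      by_cases hx : x ∈ tsupport φ
      · rw [embedNet_eq_sum ρ P w ε (hS x hx), Finset.sum_mul]
        refine Finset.sum_congr rfl fun j _ => ?_
        rw [Complex.real_smul]
        ring
      · simp [image_eq_zero_of_notMem_tsupport hx]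
    · intro j _
      exact ((cutTest (P.χ j) φ φ.contDiff).continuous.mul (continuous_cutConv w (P.ψ j)
        (ρ.scaledSchwartz ε))).integrable_of_hasCompactSupport
        (cutTest (P.χ j) φ φ.contDiff).hasCompactSupport.mul_right
  rw [embed, Gen.pair_mk]
  refine Ideal.Quotient.eq.2 fun m => ?_
  choose C hC using fun j => hw.cutConv_bound ρ (P.ψ j) (cutTest (P.χ j) φ φ.contDiff) (hg j) m
  refine ⟨∑ j ∈ S, C j, Eventually.of_forall fun ε => ?_⟩
  change ‖(∫ x, embedNet ρ P w ε x * φ x) - w φ‖ ≤ _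
  rw [hpair, ← hsum, ← Finset.sum_sub_distrib, Finset.sum_mul]
  exact norm_sum_le_of_le _ fun j _ => hC j ε

lemma Gen.pair_smul {Ω : TopologicalSpace.Opens (Space d)} (φ : 𝓓(Ω, ℂ)) (c : ℂ) (u : Gen d) :
    Gen.pair φ (c • u) = algebraMap ℂ GenNum c * Gen.pair φ u := by
  obtain ⟨u, rfl⟩ := Ideal.Quotient.mk_surjective u
  change Ideal.Quotient.mk numNegligible (pairMod φ (c • u)) =
    Ideal.Quotient.mk numNegligible (algebraMap ℂ numModerate c * pairMod φ u)
  congr 1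
  ext ε
  change ∫ x, (c * (u : Param → Space d → ℂ) ε x) * φ x =
    c * ∫ x, (u : Param → Space d → ℂ) ε x * φ x
  simp only [mul_assoc]
  exact integral_const_mul _ _

/-- A test function on an open set, as a test function on the whole space. -/
def extend {Ω : TopologicalSpace.Opens (Space d)} (φ : 𝓓(Ω, ℂ)) :
    𝓓((⊤ : TopologicalSpace.Opens (Space d)), ℂ) where
  toFun := φ
  contDiff' := φ.contDiff
  hasCompactSupport' := φ.hasCompactSupport
  tsupport_subset' := fun _ _ => trivial

lemma Gen.pair_extend {Ω : TopologicalSpace.Opens (Space d)} (φ : 𝓓(Ω, ℂ)) (u : Gen d) :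
    Gen.pair (extend φ) u = Gen.pair φ u := by
  obtain ⟨u, rfl⟩ := Ideal.Quotient.mk_surjective u
  rfl

lemma Gen.pair_scale {c : ℝ} (hc : 0 < c) (φ : 𝓓((⊤ : TopologicalSpace.Opens (Space d)), ℂ))
    (u : Gen d) : Gen.pair φ (Gen.scale c u) = Gen.pair (dilate c hc φ) u := by
  obtain ⟨u, rfl⟩ := Ideal.Quotient.mk_surjective u
  change Ideal.Quotient.mk numNegligible (pairMod φ (scaleMod d c u)) =
    Ideal.Quotient.mk numNegligible (pairMod (dilate c hc φ) u)
  congr 1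
  ext ε
  change ∫ x, (u : Param → Space d → ℂ) ε (c • x) * φ x =
    ∫ x, (u : Param → Space d → ℂ) ε x * ((((c ^ d)⁻¹ : ℝ) : ℂ) * φ (c⁻¹ • x))
  have h1 := Measure.integral_comp_inv_smul (μ := (volume : Measure (Space d)))
    (fun x => (u : Param → Space d → ℂ) ε (c • x) * φ x) c
  rw [finrank_euclideanSpace_fin, abs_of_nonneg (pow_nonneg hc.le d)] at h1
  simp only [smul_inv_smul₀ hc.ne', mul_left_comm _ ((((c ^ d)⁻¹ : ℝ) : ℂ))] at h1 ⊢
  rw [integral_const_mul, h1, Complex.real_smul, ← mul_assoc, ← Complex.ofReal_mul,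
    inv_mul_cancel₀ (pow_ne_zero d hc.ne'), Complex.ofReal_one, one_mul]

/-- The dilation is transferred to the test function, where the pairing is the classical one. The
argument works for all test functions on `ℝ^d`; those supported away from `0` are extended by zero.
-/
lemma Dist.CommutesWithIntegral.isWeaklyHomogeneous_embed {w : Dist d}
    (hw : w.CommutesWithIntegral) (ρ : Mollifier d) (P : CutoffSystem d) {α : ℝ}
    (hα : w.IsHomogeneous α) : (embed ρ P w).IsWeaklyHomogeneous α := by
  intro c hc φ
  rw [← Gen.pair_extend, ← Gen.pair_extend φ, Gen.pair_scale hc, Gen.pair_smul,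
    hw.pair_embed, hw.pair_embed, hα, map_mul]

/-! ### Limits under dilation of the cut-off -/

/-- Needed for dominated convergence along `toZero`; the `NeBot` instance below serves uniqueness of
limits. -/
instance : toZero.IsCountablyGenerated := by unfold toZero; infer_instance

lemma tendsto_coe_toZero : Tendsto (fun ε : Param => (ε : ℝ)) toZero (𝓝 0) := tendsto_comap

instance : toZero.NeBot := by
  refine comap_neBot fun t ht => ?_
  obtain ⟨δ, hδ, h⟩ := Metric.mem_nhds_iff.1 ht
  have h0 : 0 < min (δ / 2) 1 := lt_min (half_pos hδ) one_pos
  refine ⟨⟨min (δ / 2) 1, h0, min_le_right _ _⟩, h ?_⟩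
  simp only [Metric.mem_ball, dist_zero_right, Real.norm_eq_abs, abs_of_pos h0]
  linarith [min_le_left (δ / 2) 1]

/-- The test function `x ↦ ψ(ε x)`. -/
def dilTest (ε : Param) (ψ : 𝓓((⊤ : TopologicalSpace.Opens (Space d)), ℝ)) :
    𝓓((⊤ : TopologicalSpace.Opens (Space d)), ℝ) where
  toFun x := ψ ((ε : ℝ) • x)
  contDiff' := ψ.contDiff.comp (contDiff_const_smul _)
  hasCompactSupport' :=
    ψ.hasCompactSupport.comp_homeomorph (Homeomorph.smulOfNeZero (ε : ℝ) ε.2.1.ne')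
  tsupport_subset' := fun _ _ => trivial

/-- `⟨w, ψ(ε ·) r⟩` converges to `ψ(0) L(r)` for all Schwartz functions `r`. -/
def Dist.ExtendsTo (w : Dist d) (L : 𝓢(Space d, ℂ) → ℂ) : Prop :=
  ∀ (ψ : 𝓓((⊤ : TopologicalSpace.Opens (Space d)), ℝ)) (r : 𝓢(Space d, ℂ)),
    Tendsto (fun ε => w (cutTest (dilTest ε ψ) r (r.smooth _))) toZero (𝓝 (ψ 0 * L r))

lemma integrable_one_add_norm_pow_mul (r : 𝓢(Space d, ℂ)) (N : ℕ) :
    Integrable fun x => (1 + ‖x‖) ^ N * ‖r x‖ := by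
  refine ((r.integrable.norm.add (r.integrable_pow_mul volume N)).const_mul
    (2 ^ (N - 1))).mono' (Continuous.aestronglyMeasurable (by fun_prop))
    (Eventually.of_forall fun x => ?_)
  rw [Real.norm_of_nonneg (by positivity)]
  calc (1 + ‖x‖) ^ N * ‖r x‖ ≤ (2 ^ (N - 1) * (1 ^ N + ‖x‖ ^ N)) * ‖r x‖ :=
        mul_le_mul_of_nonneg_right (add_pow_le zero_le_one (norm_nonneg _) N) (norm_nonneg _)
    _ = _ := by simp only [Pi.add_apply]; ring

/-- `f` is measurable and of at most polynomial growth. -/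
structure HasPolynomialGrowth (f : Space d → ℂ) (N : ℕ) : Prop where
  measurable : Measurable f
  bound : ∀ x, ‖f x‖ ≤ (1 + ‖x‖) ^ N

lemma HasPolynomialGrowth.locallyIntegrable {f : Space d → ℂ} {N : ℕ}
    (hf : HasPolynomialGrowth f N) : LocallyIntegrable f := by
  refine (Continuous.locallyIntegrable (f := fun x : Space d => (1 + ‖x‖) ^ N)
    (by fun_prop)).mono hf.measurable.aestronglyMeasurable (Eventually.of_forall fun x => ?_)
  rw [Real.norm_of_nonneg (by positivity)]
  exact hf.bound x

lemma HasPolynomialGrowth.integrable {f : Space d → ℂ} {N : ℕ} (hf : HasPolynomialGrowth f N)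
    (r : 𝓢(Space d, ℂ)) : Integrable fun x => r x * f x := by
  refine (integrable_one_add_norm_pow_mul r N).mono'
    (r.continuous.aestronglyMeasurable.mul hf.measurable.aestronglyMeasurable)
    (Eventually.of_forall fun x => ?_)
  rw [norm_mul, mul_comm]
  exact mul_le_mul_of_nonneg_right (hf.bound x) (norm_nonneg _)

/-- Dominated convergence: `ψ(ε x) → ψ(0)` boundedly, and `r f` is integrable. -/
lemma HasPolynomialGrowth.extendsTo {f : Space d → ℂ} {N : ℕ} (hf : HasPolynomialGrowth f N) :
    (regular f).ExtendsTo fun r => ∫ x, r x * f x := by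
  intro ψ r
  obtain ⟨B, hB⟩ := (hasBoundedDerivs_testFunction ψ).exists_norm_le
  simp only [regular_apply hf.locallyIntegrable]
  rw [← integral_const_mul]
  refine tendsto_integral_filter_of_dominated_convergence (fun x => B * ‖r x * f x‖)
    (Eventually.of_forall fun ε => ?_) (Eventually.of_forall fun ε => Eventually.of_forall
      fun x => ?_) ((hf.integrable r).norm.const_mul B) (Eventually.of_forall fun x => ?_)
  · exact (cutTest (dilTest ε ψ) r (r.smooth _)).continuous.aestronglyMeasurable.mul
      hf.measurable.aestronglyMeasurable
  · change ‖(ψ ((ε : ℝ) • x) • r x) * f x‖ ≤ _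
    rw [smul_mul_assoc, norm_smul]
    exact mul_le_mul_of_nonneg_right (hB _) (norm_nonneg _)
  · change Tendsto (fun ε : Param => (ψ ((ε : ℝ) • x) • r x) * f x) toZero _
    have h1 : Tendsto (fun ε : Param => ψ ((ε : ℝ) • x)) toZero (𝓝 (ψ 0)) := by
      refine (ψ.continuous.tendsto 0).comp ?_
      simpa using tendsto_coe_toZero.smul_const x
    simpa [mul_assoc] using (h1.smul_const (r x)).mul_const (f x)

/-- A derivative falling on `ψ(ε ·)` produces a factor `ε` times a convergent quantity, so only the
derivative of `r` survives in the limit. -/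
lemma Dist.ExtendsTo.lineDeriv {w : Dist d} {L : 𝓢(Space d, ℂ) → ℂ} (hw : w.ExtendsTo L)
    (v : Space d) : (w.lineDeriv v).ExtendsTo fun r => -L (∂_{v} r) := by
  intro ψ r
  have h1 : ∀ ε : Param, w.lineDeriv v (cutTest (dilTest ε ψ) r (r.smooth _)) =
      -(((ε : ℝ) : ℂ) * w (cutTest (dilTest ε (∂_{v} ψ)) r (r.smooth _))) -
        w (cutTest (dilTest ε ψ) (∂_{v} r : 𝓢(Space d, ℂ)) (SchwartzMap.smooth _ _)) := by
    intro ε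
    have e : cutTest (∂_{v} (dilTest ε ψ)) r (r.smooth _) =
        ((ε : ℝ) : ℂ) • cutTest (dilTest ε (∂_{v} ψ)) r (r.smooth _) := by
      ext x
      change (∂_{v} (dilTest ε ψ) : 𝓓((⊤ : TopologicalSpace.Opens (Space d)), ℝ)) x • r x =
        ((ε : ℝ) : ℂ) * ((∂_{v} ψ : 𝓓((⊤ : TopologicalSpace.Opens (Space d)), ℝ)) ((ε : ℝ) • x) •
          r x)
      rw [lineDerivOp_testFunction_apply, lineDerivOp_testFunction_apply]
      have h : HasFDerivAt (dilTest ε ψ) ((fderiv ℝ ψ ((ε : ℝ) • x)).comp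
          ((ε : ℝ) • ContinuousLinearMap.id ℝ (Space d))) x :=
        (ψ.contDiff.differentiable (by simp) ((ε : ℝ) • x)).hasFDerivAt.comp x
          ((hasFDerivAt_id x).const_smul (ε : ℝ))
      rw [h.fderiv]
      simp
      ring
    rw [Dist.lineDeriv_apply, lineDerivOp_cutTest, map_add, e, map_smul, smul_eq_mul]
    rw [cutTest_congr _ _ (SchwartzMap.smooth (∂_{v} r : 𝓢(Space d, ℂ)) _)
      fun y => (SchwartzMap.lineDerivOp_apply_eq_fderiv v r y).symm]
    ring
  simp only [h1]
  have h2 : Tendsto (fun ε : Param => ((ε : ℝ) : ℂ)) toZero (𝓝 0) := by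
    simpa [Function.comp_def] using (Complex.continuous_ofReal.tendsto 0).comp tendsto_coe_toZero
  simpa using (h2.mul (hw (∂_{v} ψ) r)).neg.sub (hw ψ (∂_{v} r))

/-! ### The blow-up of the embedding at the origin -/

/-- The Schwartz function `z ↦ r(y - z)`. -/
def reflect (r : 𝓢(Space d, ℂ)) (y : Space d) : 𝓢(Space d, ℂ) :=
  SchwartzMap.compCLMOfAntilipschitz (g := fun z => y - z) (K := 1) ℂ (by fun_prop)
    (fun a b => by simp [edist_dist, dist_eq_norm, norm_sub_rev]) r

lemma reflect_apply (r : 𝓢(Space d, ℂ)) (y z : Space d) : reflect r y z = r (y - z) := rfl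

/-- The test function `z ↦ ψ(z) ρ_ε(ε y - z)` is the dilation by `ε` of `z ↦ ψ(ε z) ρ(y - z)`. -/
lemma cutConv_scaled (ρ : Mollifier d) {w : Dist d} {α : ℝ} (hw : w.IsHomogeneous α)
    (ψ : 𝓓((⊤ : TopologicalSpace.Opens (Space d)), ℝ)) (ε : Param) (y : Space d) :
    cutConv w ψ (ρ.scaled ε) (ρ.contDiff_scaled ε) ((ε : ℝ) • y) =
      (((ε : ℝ) ^ α : ℝ) : ℂ) *
        w (cutTest (dilTest ε ψ) (reflect ρ.ρ y) (SchwartzMap.smooth _ _)) := by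
  have hε : (ε : ℝ) ≠ 0 := ε.2.1.ne'
  rw [← hw ε ε.2.1]
  unfold cutConv
  congr 1
  ext z
  change ψ z • (((((ε : ℝ) ^ d)⁻¹ : ℝ) : ℂ) * ρ.ρ ((ε : ℝ)⁻¹ • ((ε : ℝ) • y - z))) =
    ((((ε : ℝ) ^ d)⁻¹ : ℝ) : ℂ) * (ψ ((ε : ℝ) • (ε : ℝ)⁻¹ • z) • ρ.ρ (y - (ε : ℝ)⁻¹ • z))
  rw [smul_inv_smul₀ hε, smul_sub, inv_smul_smul₀ hε, mul_smul_comm]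

lemma smul_mem_closedBall (ε : Param) (y : Space d) :
    (ε : ℝ) • y ∈ Metric.closedBall (0 : Space d) ‖y‖ := by
  rw [mem_closedBall_zero_iff, norm_smul, Real.norm_of_nonneg ε.2.1.le]
  exact mul_le_of_le_one_left (norm_nonneg _) ε.2.2

/-- The limit is `(w * ρ)(y)`: the partition of unity and the cut-offs contribute only their values
at `0`, and `∑ χ_j(0) ψ_j(0) = ∑ χ_j(0) = 1`. -/
lemma tendsto_embedNet (ρ : Mollifier d) (P : CutoffSystem d) {w : Dist d} {α : ℝ}
    (hα : w.IsHomogeneous α) {L : 𝓢(Space d, ℂ) → ℂ} (hL : w.ExtendsTo L) (y : Space d) :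
    Tendsto (fun ε : Param => ((((ε : ℝ) ^ α)⁻¹ : ℝ) : ℂ) * embedNet ρ P w ε ((ε : ℝ) • y))
      toZero (𝓝 (L (reflect ρ.ρ y))) := by
  obtain ⟨S, hS⟩ := P.exists_finset (isCompact_closedBall (0 : Space d) ‖y‖)
  have h1 : ∀ ε : Param, ((((ε : ℝ) ^ α)⁻¹ : ℝ) : ℂ) * embedNet ρ P w ε ((ε : ℝ) • y) =
      ∑ j ∈ S, (P.χ j ((ε : ℝ) • y) : ℂ) *
        w (cutTest (dilTest ε (P.ψ j)) (reflect ρ.ρ y) (SchwartzMap.smooth _ _)) := by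
    intro ε
    rw [embedNet_eq_sum ρ P w ε (hS _ (smul_mem_closedBall ε y)), Finset.mul_sum]
    refine Finset.sum_congr rfl fun j _ => ?_
    rw [cutConv_scaled ρ hα, mul_left_comm, ← mul_assoc (((((ε : ℝ) ^ α)⁻¹ : ℝ) : ℂ)),
      ← Complex.ofReal_mul, inv_mul_cancel₀ (Real.rpow_pos_of_pos ε.2.1 α).ne',
      Complex.ofReal_one, one_mul]
  simp only [h1]
  have h2 : L (reflect ρ.ρ y) =
      ∑ j ∈ S, (P.χ j 0 : ℂ) * ((P.ψ j 0 : ℂ) * L (reflect ρ.ρ y)) := by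
    simp only [← mul_assoc, ← Complex.ofReal_mul, mul_comm (P.χ _ 0), P.ψ_mul_χ]
    rw [← Finset.sum_mul, ← Complex.ofReal_sum, P.sum_eq_one_of_forall (hS 0 (by simp)),
      Complex.ofReal_one, one_mul]
  rw [h2]
  refine tendsto_finsetSum _ fun j _ => Tendsto.mul ?_ (hL (P.ψ j) _)
  have h3 : Tendsto (fun ε : Param => P.χ j ((ε : ℝ) • y)) toZero (𝓝 (P.χ j 0)) := by
    refine ((P.χ j).continuous.tendsto 0).comp ?_
    simpa using tendsto_coe_toZero.smul_const y
  exact (Complex.continuous_ofReal.tendsto _).comp h3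

lemma eq_of_isHomogeneous_embed (ρ : Mollifier d) (P : CutoffSystem d) {w : Dist d} {α β : ℝ}
    (hα : w.IsHomogeneous α) {L : 𝓢(Space d, ℂ) → ℂ} (hL : w.ExtendsTo L)
    (hβ : (embed ρ P w).IsHomogeneous β) {c : ℝ} (hc : 0 < c) (y : Space d) :
    L (reflect ρ.ρ (c • y)) = ((c ^ β : ℝ) : ℂ) * L (reflect ρ.ρ y) := by
  have h1 : scaleMod d c ⟨embedNet ρ P w, embedNet_mem_moderate ρ P w⟩ -
      ((c ^ β : ℝ) : ℂ) • ⟨embedNet ρ P w, embedNet_mem_moderate ρ P w⟩ ∈ negligible d :=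
    Ideal.Quotient.eq.1 (hβ c hc)
  -- With the exponent `⌈α⌉₊ + 1`, division by `ε^α` still leaves a factor `ε`. The points `ε y`
  -- stay in the ball of radius `‖y‖`.
  obtain ⟨C, hC⟩ := h1 _ (isCompact_closedBall (0 : Space d) ‖y‖) 0 (⌈α⌉₊ + 1)
  refine sub_eq_zero.1 (tendsto_nhds_unique
    ((tendsto_embedNet ρ P hα hL (c • y)).sub
      ((tendsto_embedNet ρ P hα hL y).const_mul ((c ^ β : ℝ) : ℂ))) ?_)
  refine squeeze_zero_norm' (a := fun ε : Param => C * (ε : ℝ)) ?_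
    (by simpa using tendsto_coe_toZero.const_mul C)
  filter_upwards [hC] with ε hC
  have h2 := hC _ (smul_mem_closedBall ε y)
  rw [norm_iteratedFDeriv_zero] at h2
  change ‖embedNet ρ P w ε (c • (ε : ℝ) • y) - ((c ^ β : ℝ) : ℂ) * embedNet ρ P w ε ((ε : ℝ) • y)‖
    ≤ _ at h2
  have hC0 : 0 ≤ C := nonneg_of_mul_nonneg_left ((norm_nonneg _).trans h2) (pow_pos ε.2.1 _)
  have h3 : ((ε : ℝ) ^ α)⁻¹ * (ε : ℝ) ^ ⌈α⌉₊ ≤ 1 := by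
    rw [inv_mul_le_one₀ (Real.rpow_pos_of_pos ε.2.1 α), ← Real.rpow_natCast]
    exact Real.rpow_le_rpow_of_exponent_ge ε.2.1 ε.2.2 (Nat.le_ceil α)
  have h4 : 0 ≤ ((ε : ℝ) ^ α)⁻¹ := inv_nonneg.2 (Real.rpow_nonneg ε.2.1.le α)
  rw [smul_comm, mul_left_comm, ← mul_sub, norm_mul, Complex.norm_real, Real.norm_of_nonneg h4]
  calc ((ε : ℝ) ^ α)⁻¹ * _ ≤ ((ε : ℝ) ^ α)⁻¹ * (C * (ε : ℝ) ^ (⌈α⌉₊ + 1)) :=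
        mul_le_mul_of_nonneg_left h2 h4
    _ = C * (ε : ℝ) * (((ε : ℝ) ^ α)⁻¹ * (ε : ℝ) ^ ⌈α⌉₊) := by ring
    _ ≤ C * (ε : ℝ) := mul_le_of_le_one_right (mul_nonneg hC0 ε.2.1.le) h3

/-! ### Smooth homogeneous functions that decay rapidly at `-∞` -/

/-- Flatness at `0`: each use of the mean value inequality, starting from `h i 0 = 0`, gains one
power of `t`. -/
lemma exists_norm_le_mul_pow {h : ℕ → ℝ → ℂ} (hd : ∀ i t, HasDerivAt (h i) (h (i + 1) t) t)
    (h0 : ∀ i, h i 0 = 0) (n : ℕ) :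
    ∀ i, ∃ M, 0 ≤ M ∧ ∀ t ∈ Set.Icc (0 : ℝ) 1, ‖h i t‖ ≤ M * t ^ n := by
  induction n with
  | zero =>
    intro i
    obtain ⟨M, hM⟩ := isCompact_Icc.exists_bound_of_continuousOn (s := Set.Icc (0 : ℝ) 1)
      (f := h i) fun t _ => (hd i t).continuousAt.continuousWithinAt
    exact ⟨M, (norm_nonneg _).trans (hM 0 (by simp)), fun t ht => by simpa using hM t ht⟩
  | succ n ih =>
    intro i
    obtain ⟨M, hM0, hM⟩ := ih (i + 1)
    refine ⟨M, hM0, fun t ht => ?_⟩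
    have key := (convex_Icc (0 : ℝ) t).norm_image_sub_le_of_norm_hasDerivWithin_le (f := h i)
      (f' := h (i + 1)) (C := M * t ^ n) (fun x _ => (hd i x).hasDerivWithinAt)
      (fun x hx => (hM x ⟨hx.1, hx.2.trans ht.2⟩).trans
        (mul_le_mul_of_nonneg_left (pow_le_pow_left₀ hx.1 hx.2 n) hM0))
      (Set.left_mem_Icc.2 ht.1) (Set.right_mem_Icc.2 ht.1)
    rw [h0, sub_zero, sub_zero, Real.norm_of_nonneg ht.1] at key
    rw [pow_succ, ← mul_assoc]
    exact key

/-- Here `h i` is the `i`-th derivative of `h 0`, and only `h k` is homogeneous. Decay kills `h k`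
on the negative axis, flatness at `0` kills it on the positive axis, and decay again fixes the
constants of integration from `h k` down to `h 0`. -/
lemma eq_zero_of_homogeneous_of_decay {h : ℕ → ℝ → ℂ}
    (hd : ∀ i t, HasDerivAt (h i) (h (i + 1) t) t)
    (hdecay : ∀ i n : ℕ, ∃ B, ∀ t < 0, |t| ^ n * ‖h i t‖ ≤ B) {k : ℕ} {β : ℝ}
    (hβ : ∀ c : ℝ, 0 < c → ∀ t, h k (c * t) = ((c ^ β : ℝ) : ℂ) * h k t) (t : ℝ) : h 0 t = 0 := by
  have hneg : ∀ t < 0, h k t = 0 := by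
    intro t ht
    -- This makes `n + β > 0`, so the decay bound at `c t` forces `h k t = 0` as `c → ∞`.
    set n := ⌈-β⌉₊ + 1 with hn
    have hnβ : 0 < (n : ℝ) + β := by
      have := Nat.le_ceil (-β)
      push_cast [hn]
      linarith
    obtain ⟨B, hB⟩ := hdecay k n
    have h1 : ∀ᶠ c : ℝ in atTop, |t| ^ n * ‖h k t‖ ≤ B * c ^ (-((n : ℝ) + β)) := by
      filter_upwards [eventually_gt_atTop 0] with c hc
      have h2 := hB (c * t) (mul_neg_of_pos_of_neg hc ht)
      rw [hβ c hc, norm_mul, Complex.norm_real, Real.norm_of_nonneg (Real.rpow_nonneg hc.le _),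
        abs_mul, abs_of_pos hc, mul_pow] at h2
      rw [Real.rpow_neg hc.le, ← div_eq_mul_inv, le_div_iff₀ (Real.rpow_pos_of_pos hc _),
        Real.rpow_add hc, Real.rpow_natCast]
      linarith
    have h3 := (tendsto_rpow_neg_atTop hnβ).const_mul B
    rw [mul_zero] at h3
    have h4 : |t| ^ n * ‖h k t‖ ≤ 0 := ge_of_tendsto h3 h1
    have h5 : 0 < |t| ^ n := pow_pos (abs_pos.2 ht.ne) n
    exact norm_le_zero_iff.1 (nonpos_of_mul_nonpos_right h4 h5)
  have hneg' : ∀ j, ∀ t < 0, h (k + j) t = 0 := by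
    intro j
    induction j with
    | zero => exact hneg
    | succ j ih =>
      intro t ht
      refine (hd (k + j) t).unique ((hasDerivAt_const t (0 : ℂ)).congr_of_eventuallyEq ?_)
      filter_upwards [Iio_mem_nhds ht] with x hx using ih x hx
  have hzero : ∀ j, h (k + j) 0 = 0 := by
    intro j
    have hc : Continuous (h (k + j)) :=
      continuous_iff_continuousAt.2 fun t => (hd (k + j) t).continuousAt
    have h1 : closure (Set.Iio (0 : ℝ)) ⊆ {t | h (k + j) t = 0} :=
      closure_minimal (fun t ht => hneg' j t ht) (isClosed_eq hc continuous_const)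
    rw [closure_Iio] at h1
    exact h1 (Set.mem_Iic.2 le_rfl)
  -- Homogeneity gives `h k t = t^β h k 1`, while flatness bounds this by `M t^(⌈β⌉₊ + 1)`; dividing
  -- by `t^β` leaves `‖h k 1‖ ≤ M t` for small `t > 0`.
  have hone : h k 1 = 0 := by
    obtain ⟨M, hM0, hM⟩ := exists_norm_le_mul_pow (h := fun j => h (k + j))
      (fun j t => hd (k + j) t) hzero (⌈β⌉₊ + 1) 0
    have h1 : ∀ᶠ t : ℝ in 𝓝[>] 0, ‖h k 1‖ ≤ M * t := by
      filter_upwards [Ioo_mem_nhdsGT (one_pos : (0 : ℝ) < 1)] with t ht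
      have h2 := hM t ⟨ht.1.le, ht.2.le⟩
      have h3 := hβ t ht.1 1
      rw [mul_one] at h3
      have h4 : t ^ ⌈β⌉₊ ≤ t ^ β := by
        rw [← Real.rpow_natCast]
        exact Real.rpow_le_rpow_of_exponent_ge ht.1 ht.2.le (Nat.le_ceil β)
      rw [add_zero, h3, norm_mul, Complex.norm_real,
        Real.norm_of_nonneg (Real.rpow_nonneg ht.1.le _), pow_succ] at h2
      have h5 : 0 < t ^ β := Real.rpow_pos_of_pos ht.1 β
      refine le_of_mul_le_mul_left (h2.trans ?_) h5
      calc M * (t ^ ⌈β⌉₊ * t) = t ^ ⌈β⌉₊ * (M * t) := by ring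
        _ ≤ t ^ β * (M * t) := mul_le_mul_of_nonneg_right h4 (mul_nonneg hM0 ht.1.le)
    have h2 : Tendsto (fun t : ℝ => M * t) (𝓝[>] 0) (𝓝 0) := by
      simpa using (tendsto_id.mono_left nhdsWithin_le_nhds :
        Tendsto id (𝓝[>] (0 : ℝ)) (𝓝 0)).const_mul M
    exact norm_le_zero_iff.1 (ge_of_tendsto h2 h1)
  have hk : ∀ t, h k t = 0 := by
    intro t
    rcases lt_trichotomy t 0 with ht | ht | ht
    · exact hneg t ht
    · rw [ht]; exact hzero 0
    · have := hβ t ht 1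
      rwa [mul_one, hone, mul_zero] at this
  have hdown : ∀ i, (∀ t, h (i + 1) t = 0) → ∀ t, h i t = 0 := by
    intro i hi t
    have hconst : ∀ x, h i x = h i t := fun x =>
      is_const_of_deriv_eq_zero (fun x => (hd i x).differentiableAt)
        (fun x => by rw [(hd i x).deriv, hi]) x t
    obtain ⟨B, hB⟩ := hdecay i 1
    by_contra hne
    have hpos : 0 < ‖h i t‖ := norm_pos_iff.2 hne
    -- At this point the decay bound with exponent `1` for the constant `h i` reads `|B| + 1 ≤ B`.
    have h1 := hB (-((|B| + 1) / ‖h i t‖)) (by rw [neg_lt_zero]; positivity)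
    rw [hconst (-((|B| + 1) / ‖h i t‖)), pow_one, abs_neg,
      abs_of_pos (by positivity), div_mul_cancel₀ _ hpos.ne'] at h1
    linarith [le_abs_self B]
  have hall : ∀ j, ∀ t, h (k - j) t = 0 := by
    intro j
    induction j with
    | zero => exact hk
    | succ j ih =>
      -- Subtraction is truncated: for `j ≥ k` both indices are `0` and nothing changes.
      rcases Nat.lt_or_ge j k with hj | hj
      · refine hdown (k - (j + 1)) ?_
        rwa [show k - (j + 1) + 1 = k - j by omega]
      · rwa [show k - (j + 1) = k - j by omega]
  simpa using hall k t

/-! ### A family of homogeneous distributions -/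

/-- The vector `(1, …, 1)`. -/
def diag (d : ℕ) : Space d := WithLp.toLp 2 fun _ => 1

lemma diag_apply (i : Fin d) : diag d i = 1 := rfl

/-- The function `x ↦ ‖x‖^s H(x_1) ⋯ H(x_d)`. -/
def orthantPower (d : ℕ) (s : ℝ) (x : Space d) : ℂ :=
  ((‖x‖ ^ s : ℝ) : ℂ) * ∏ i, heaviside (x i)

lemma heaviside_mul {c : ℝ} (hc : 0 < c) (t : ℝ) : heaviside (c * t) = heaviside t := by
  simp [heaviside, hc]

lemma orthantPower_smul (s : ℝ) {c : ℝ} (hc : 0 < c) (x : Space d) :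
    orthantPower d s (c • x) = ((c ^ s : ℝ) : ℂ) * orthantPower d s x := by
  unfold orthantPower
  rw [norm_smul, Real.norm_of_nonneg hc.le, Real.mul_rpow hc.le (norm_nonneg x)]
  simp only [PiLp.smul_apply, smul_eq_mul, heaviside_mul hc]
  push_cast
  ring

lemma hasPolynomialGrowth_orthantPower {s : ℝ} (hs : 0 ≤ s) :
    HasPolynomialGrowth (orthantPower d s) ⌈s⌉₊ := by
  refine ⟨?_, fun x => ?_⟩
  · refine Measurable.mul (Complex.measurable_ofReal.comp (measurable_norm.pow_const s))
      (Finset.measurable_fun_prod _ fun i _ => ?_)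
    exact (Measurable.ite measurableSet_Ioi measurable_const measurable_const).comp
      (by fun_prop : Measurable fun x : Space d => x i)
  · have h1 : ‖∏ i, heaviside (x i)‖ ≤ 1 := by
      rw [norm_prod]
      refine Finset.prod_le_one (fun i _ => norm_nonneg _) fun i _ => ?_
      unfold heaviside
      split_ifs <;> simp
    have h2 : ‖x‖ ^ s ≤ (1 + ‖x‖) ^ ⌈s⌉₊ :=
      calc ‖x‖ ^ s ≤ (1 + ‖x‖) ^ s :=
            Real.rpow_le_rpow (norm_nonneg x) (by linarith) hs
        _ ≤ (1 + ‖x‖) ^ (⌈s⌉₊ : ℝ) :=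
            Real.rpow_le_rpow_of_exponent_le (by linarith [norm_nonneg x]) (Nat.le_ceil s)
        _ = _ := Real.rpow_natCast _ _
    unfold orthantPower
    rw [norm_mul, Complex.norm_real, Real.norm_of_nonneg (Real.rpow_nonneg (norm_nonneg x) s)]
    calc _ ≤ (1 + ‖x‖) ^ ⌈s⌉₊ * 1 :=
          mul_le_mul h2 h1 (norm_nonneg _) (by positivity)
      _ = _ := mul_one _

/-- The derivative of order `k` in the direction `(1, …, 1)` of `‖x‖^s H(x_1) ⋯ H(x_d)`. -/
def orthantDist (d : ℕ) (s : ℝ) : ℕ → Dist d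
  | 0 => regular (orthantPower d s)
  | k + 1 => (orthantDist d s k).lineDeriv (diag d)

/-- The extension of `orthantDist d s k` to Schwartz functions. -/
def orthantFunctional (d : ℕ) (s : ℝ) : ℕ → 𝓢(Space d, ℂ) → ℂ
  | 0 => fun r => ∫ x, r x * orthantPower d s x
  | k + 1 => fun r => -orthantFunctional d s k (∂_{diag d} r)

lemma isHomogeneous_orthantDist {s : ℝ} (hs : 0 ≤ s) (k : ℕ) :
    (orthantDist d s k).IsHomogeneous (s - k) := by
  induction k with
  | zero =>
    rw [Nat.cast_zero, sub_zero]
    exact isHomogeneous_regular (hasPolynomialGrowth_orthantPower hs).locallyIntegrable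
      fun c hc => orthantPower_smul s hc
  | succ k ih =>
    rw [Nat.cast_succ, ← sub_sub]
    exact ih.lineDeriv _

lemma commutesWithIntegral_orthantDist {s : ℝ} (hs : 0 ≤ s) (k : ℕ) :
    (orthantDist d s k).CommutesWithIntegral := by
  induction k with
  | zero =>
    exact commutesWithIntegral_regular (hasPolynomialGrowth_orthantPower hs).locallyIntegrable
  | succ k ih => exact ih.lineDeriv _

lemma extendsTo_orthantDist {s : ℝ} (hs : 0 ≤ s) (k : ℕ) :
    (orthantDist d s k).ExtendsTo (orthantFunctional d s k) := by
  induction k with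
  | zero => exact (hasPolynomialGrowth_orthantPower hs).extendsTo
  | succ k ih => exact ih.lineDeriv _

lemma orthantFunctional_neg (s : ℝ) (k : ℕ) : ∀ r : 𝓢(Space d, ℂ),
    orthantFunctional d s k (-r) = -orthantFunctional d s k r := by
  induction k with
  | zero =>
    intro r
    simp only [orthantFunctional, neg_apply, neg_mul, integral_neg]
  | succ k ih =>
    intro r
    change -orthantFunctional d s k (∂_{diag d} (-r)) = -(-orthantFunctional d s k (∂_{diag d} r))
    rw [lineDerivOp_neg, ih]

lemma lineDerivOp_reflect (v : Space d) (r : 𝓢(Space d, ℂ)) (y : Space d) :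
    ∂_{v} (reflect r y) = -reflect (∂_{v} r) y := by
  ext z
  rw [SchwartzMap.lineDerivOp_apply_eq_fderiv, neg_apply, reflect_apply,
    SchwartzMap.lineDerivOp_apply_eq_fderiv]
  have h : HasFDerivAt (reflect r y)
      ((fderiv ℝ r (y - z)).comp (-(ContinuousLinearMap.id ℝ (Space d)))) z :=
    (r.differentiable (y - z)).hasFDerivAt.comp z ((hasFDerivAt_id z).const_sub y)
  rw [h.fderiv]
  simp

/-- The convolution of `r` with `‖x‖^s H(x_1) ⋯ H(x_d)`, along the diagonal. -/
def profile (s : ℝ) (r : 𝓢(Space d, ℂ)) (t : ℝ) : ℂ :=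
  ∫ z, r (t • diag d - z) * orthantPower d s z

/-- The sign from transposing the derivative cancels the sign from differentiating `r(y - z)` in
`z`. -/
lemma orthantFunctional_reflect (s : ℝ) (k : ℕ) (t : ℝ) : ∀ r : 𝓢(Space d, ℂ),
    orthantFunctional d s k (reflect r (t • diag d)) =
      profile s ((fun r : 𝓢(Space d, ℂ) => (∂_{diag d} r : 𝓢(Space d, ℂ)))^[k] r) t := by
  induction k with
  | zero => intro r; rfl
  | succ k ih =>
    intro r
    change -orthantFunctional d s k (∂_{diag d} (reflect r (t • diag d))) = _
    rw [lineDerivOp_reflect, orthantFunctional_neg, neg_neg, ih, Function.iterate_succ_apply]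

/-- Differentiation under the integral. For `|t - t₀| < 1` one has `1 + ‖z‖ ≤ A (1 + ‖t e - z‖)`, so
the decay of `∂_e r` at `t e - z` becomes decay in `z`, uniformly in `t`. The exponent `N + (d + 1)`
pays `N` for the growth of the density and `d + 1` for integrability. -/
lemma hasDerivAt_profile {s : ℝ} (hs : 0 ≤ s) (r : 𝓢(Space d, ℂ)) (t₀ : ℝ) :
    HasDerivAt (profile s r) (profile s (∂_{diag d} r) t₀) t₀ := by
  have hf := hasPolynomialGrowth_orthantPower (d := d) hs
  set N := ⌈s⌉₊
  set q : 𝓢(Space d, ℂ) := ∂_{diag d} r with hq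
  set A : ℝ := 1 + (|t₀| + 1) * ‖diag d‖ with hA
  have hA0 : 0 ≤ A := by positivity
  set C : ℝ := 2 ^ (N + (d + 1)) * ((Finset.Iic (N + (d + 1), 0)).sup
    fun m => SchwartzMap.seminorm ℝ m.1 m.2) q with hC
  have hqC : ∀ x, (1 + ‖x‖) ^ (N + (d + 1)) * ‖q x‖ ≤ C := fun x => by
    have := SchwartzMap.one_add_le_sup_seminorm_apply (𝕜 := ℝ) (m := (N + (d + 1), 0))
      (k := N + (d + 1)) (n := 0) le_rfl le_rfl q x
    rwa [norm_iteratedFDeriv_zero] at this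
  have hmeas : ∀ (p : 𝓢(Space d, ℂ)) (t : ℝ), Integrable
      fun z => p (t • diag d - z) * orthantPower d s z := fun p t =>
    hf.integrable (reflect p (t • diag d))
  refine (hasDerivAt_integral_of_dominated_loc_of_deriv_le (Metric.ball_mem_nhds t₀ one_pos)
    (F := fun t z => r (t • diag d - z) * orthantPower d s z)
    (F' := fun t z => q (t • diag d - z) * orthantPower d s z)
    (bound := fun z => A ^ (N + (d + 1)) * C * (1 + ‖z‖) ^ (-((d : ℝ) + 1)))
    (Eventually.of_forall fun t => (hmeas r t).aestronglyMeasurable) (hmeas r t₀)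
    (hmeas q t₀).aestronglyMeasurable (Eventually.of_forall fun z t ht => ?_)
    ((integrable_one_add_norm (by simp)).const_mul _)
    (Eventually.of_forall fun z t _ => ?_)).2
  · have ht' : |t| ≤ |t₀| + 1 := by
      rw [Metric.mem_ball, Real.dist_eq] at ht
      have := abs_sub_abs_le_abs_sub t t₀
      linarith
    have h1 : 1 + ‖z‖ ≤ A * (1 + ‖t • diag d - z‖) := by
      have h2 : ‖z‖ ≤ ‖t • diag d‖ + ‖t • diag d - z‖ := by
        have := norm_sub_le (t • diag d) (t • diag d - z)
        rwa [sub_sub_cancel] at this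
      have h3 : ‖t • diag d‖ ≤ (|t₀| + 1) * ‖diag d‖ := by
        rw [norm_smul]
        exact mul_le_mul_of_nonneg_right ht' (norm_nonneg _)
      have h4 : 0 ≤ (|t₀| + 1) * ‖diag d‖ * ‖t • diag d - z‖ := by positivity
      rw [hA]
      linarith
    have h5 : (0 : ℝ) < 1 + ‖z‖ := by positivity
    rw [norm_mul, Real.rpow_neg h5.le, ← div_eq_mul_inv, le_div_iff₀ (Real.rpow_pos_of_pos h5 _),
      show ((d : ℝ) + 1) = ((d + 1 : ℕ) : ℝ) by push_cast; ring, Real.rpow_natCast]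
    calc ‖q (t • diag d - z)‖ * ‖orthantPower d s z‖ * (1 + ‖z‖) ^ (d + 1)
        ≤ ‖q (t • diag d - z)‖ * (1 + ‖z‖) ^ N * (1 + ‖z‖) ^ (d + 1) := by
          gcongr
          exact hf.bound z
      _ = ‖q (t • diag d - z)‖ * (1 + ‖z‖) ^ (N + (d + 1)) := by ring
      _ ≤ ‖q (t • diag d - z)‖ * (A * (1 + ‖t • diag d - z‖)) ^ (N + (d + 1)) := by gcongr
      _ = A ^ (N + (d + 1)) *
          ((1 + ‖t • diag d - z‖) ^ (N + (d + 1)) * ‖q (t • diag d - z)‖) := by rw [mul_pow]; ring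
      _ ≤ _ := mul_le_mul_of_nonneg_left (hqC _) (by positivity)
  · have h1 : HasDerivAt (fun t : ℝ => t • diag d - z) (diag d) t := by
      simpa using ((hasDerivAt_id t).smul_const (diag d)).sub_const z
    have h2 := (r.differentiable (t • diag d - z)).hasFDerivAt.comp_hasDerivAt t h1
    rw [hq, SchwartzMap.lineDerivOp_apply_eq_fderiv]
    exact h2.mul_const _

lemma profile_eq (s : ℝ) (r : 𝓢(Space d, ℂ)) (t : ℝ) :
    profile s r t = ∫ z, r z * orthantPower d s (t • diag d - z) := by
  rw [← integral_sub_left_eq_self (fun z => r z * orthantPower d s (t • diag d - z)) volume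
    (t • diag d)]
  simp [profile]

/-- For `t < 0` the integrand vanishes unless `t e - z` lies in the positive orthant. Then `z_0 < t
< 0`, so `|t| ≤ ‖z‖` and powers of `|t|` are absorbed by the Schwartz decay of `r`. A coordinate
exists because `d ≥ 1`. -/
lemma profile_decay (hd : 1 ≤ d) {s : ℝ} (hs : 0 ≤ s) (r : 𝓢(Space d, ℂ)) (n : ℕ) :
    ∃ B, ∀ t < 0, |t| ^ n * ‖profile s r t‖ ≤ B := by
  have hf := hasPolynomialGrowth_orthantPower (d := d) hs
  set N := ⌈s⌉₊
  refine ⟨∫ z, (1 + ‖diag d‖) ^ N * ((1 + ‖z‖) ^ (N + n) * ‖r z‖), fun t ht => ?_⟩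
  rw [profile_eq, ← Real.norm_of_nonneg (pow_nonneg (abs_nonneg t) n), ← norm_smul,
    ← integral_smul]
  refine norm_integral_le_of_norm_le ((integrable_one_add_norm_pow_mul r (N + n)).const_mul _)
    (Eventually.of_forall fun z => ?_)
  rw [norm_smul, norm_mul, Real.norm_of_nonneg (pow_nonneg (abs_nonneg t) n)]
  by_cases h0 : orthantPower d s (t • diag d - z) = 0
  · rw [h0, norm_zero, mul_zero, mul_zero]
    positivity
  · have h1 : |t| ≤ ‖z‖ := by
      have h2 : heaviside ((t • diag d - z) ⟨0, hd⟩) ≠ 0 :=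
        Finset.prod_ne_zero_iff.1 (right_ne_zero_of_mul h0) _ (Finset.mem_univ _)
      have h3 : 0 < t - z ⟨0, hd⟩ := by
        by_contra h
        refine h2 (if_neg ?_)
        simpa [diag_apply] using h
      refine le_trans ?_ (PiLp.norm_apply_le z ⟨0, hd⟩)
      rw [Real.norm_eq_abs, abs_of_neg ht, abs_of_neg (by linarith)]
      linarith
    have h4 : 1 + ‖t • diag d - z‖ ≤ (1 + ‖diag d‖) * (1 + ‖z‖) := by
      have h5 := norm_sub_le (t • diag d) z
      rw [norm_smul, Real.norm_eq_abs] at h5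
      have h6 : |t| * ‖diag d‖ ≤ ‖z‖ * ‖diag d‖ := mul_le_mul_of_nonneg_right h1 (norm_nonneg _)
      linarith [norm_nonneg (diag d)]
    calc |t| ^ n * (‖r z‖ * ‖orthantPower d s (t • diag d - z)‖)
        ≤ (1 + ‖z‖) ^ n * (‖r z‖ * ((1 + ‖diag d‖) * (1 + ‖z‖)) ^ N) := by
          gcongr
          · linarith
          · exact (hf.bound _).trans (by gcongr)
      _ = _ := by rw [mul_pow]; ring

/-- By homogeneity the left side is the integral of `r(z)` against the density at `e - z / t`. The
density is continuous at `e`, an interior point of the orthant, and dominated convergence applies.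
-/
lemma tendsto_profile {s : ℝ} (hs : 0 ≤ s) (r : 𝓢(Space d, ℂ)) :
    Tendsto (fun t : ℝ => (((t ^ s)⁻¹ : ℝ) : ℂ) * profile s r t) atTop
      (𝓝 ((∫ z, r z) * ((‖diag d‖ ^ s : ℝ) : ℂ))) := by
  have hf := hasPolynomialGrowth_orthantPower (d := d) hs
  set N := ⌈s⌉₊
  have hcont : Tendsto (orthantPower d s) (𝓝 (diag d)) (𝓝 ((‖diag d‖ ^ s : ℝ) : ℂ)) := by
    have h1 : Tendsto (fun x : Space d => ((‖x‖ ^ s : ℝ) : ℂ)) (𝓝 (diag d))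
        (𝓝 ((‖diag d‖ ^ s : ℝ) : ℂ)) :=
      (Complex.continuous_ofReal.comp
        (continuous_norm.rpow_const fun _ => Or.inr hs)).tendsto _
    refine h1.congr' ?_
    have h2 : ∀ᶠ x : Space d in 𝓝 (diag d), ∀ i, 0 < x i := by
      refine eventually_all.2 fun i => ?_
      exact (by fun_prop : Continuous fun x : Space d => x i).continuousAt.eventually
        (lt_mem_nhds (one_pos : (0 : ℝ) < diag d i))
    filter_upwards [h2] with x hx
    have h3 : ∏ i, heaviside (x i) = 1 := Finset.prod_eq_one fun i _ => if_pos (hx i)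
    rw [orthantPower, h3, mul_one]
  rw [← integral_mul_const]
  have h1 : ∀ᶠ t : ℝ in atTop, ∫ z, r z * orthantPower d s (diag d - t⁻¹ • z) =
      (((t ^ s)⁻¹ : ℝ) : ℂ) * profile s r t := by
    filter_upwards [eventually_gt_atTop 0] with t ht
    rw [profile_eq, ← integral_const_mul]
    refine integral_congr_ae (Eventually.of_forall fun z => ?_)
    have h2 : t • diag d - z = t • (diag d - t⁻¹ • z) := by
      rw [smul_sub, smul_inv_smul₀ ht.ne']
    simp only [h2, orthantPower_smul s ht]
    rw [mul_left_comm, ← mul_assoc (((t ^ s)⁻¹ : ℝ) : ℂ), ← Complex.ofReal_mul,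
      inv_mul_cancel₀ (Real.rpow_pos_of_pos ht s).ne', Complex.ofReal_one, one_mul]
  refine Tendsto.congr' h1 (tendsto_integral_filter_of_dominated_convergence
    (fun z => (1 + ‖diag d‖) ^ N * ((1 + ‖z‖) ^ N * ‖r z‖)) (Eventually.of_forall fun t => ?_) ?_
    ((integrable_one_add_norm_pow_mul r N).const_mul _) (Eventually.of_forall fun z => ?_))
  · exact r.continuous.aestronglyMeasurable.mul (hf.measurable.comp
      (by fun_prop : Measurable fun z : Space d => diag d - t⁻¹ • z)).aestronglyMeasurable
  · filter_upwards [eventually_ge_atTop 1] with t ht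
    refine Eventually.of_forall fun z => ?_
    have h3 : 1 + ‖diag d - t⁻¹ • z‖ ≤ (1 + ‖diag d‖) * (1 + ‖z‖) := by
      have h5 := norm_sub_le (diag d) (t⁻¹ • z)
      rw [norm_smul, norm_inv, Real.norm_of_nonneg (by linarith)] at h5
      have h6 : t⁻¹ * ‖z‖ ≤ ‖z‖ :=
        mul_le_of_le_one_left (norm_nonneg _) (inv_le_one_of_one_le₀ ht)
      linarith [mul_nonneg (norm_nonneg (diag d)) (norm_nonneg z)]
    rw [norm_mul]
    calc ‖r z‖ * ‖orthantPower d s (diag d - t⁻¹ • z)‖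
        ≤ ‖r z‖ * ((1 + ‖diag d‖) * (1 + ‖z‖)) ^ N := by
          gcongr
          exact (hf.bound _).trans (by gcongr)
      _ = _ := by rw [mul_pow]; ring
  · refine (hcont.comp ?_).const_mul _
    have h7 : Tendsto (fun t : ℝ => diag d - t⁻¹ • z) atTop (𝓝 (diag d - (0 : ℝ) • z)) :=
      (tendsto_inv_atTop_zero.smul_const z).const_sub _
    simpa using h7

lemma not_isHomogeneous_embed_orthantDist (hd : 1 ≤ d) (ρ : Mollifier d) (P : CutoffSystem d)
    {s : ℝ} (hs : 0 ≤ s) (k : ℕ) (β : ℝ) : ¬ (embed ρ P (orthantDist d s k)).IsHomogeneous β := by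
  intro hβ
  set h : ℕ → ℝ → ℂ := fun i =>
    profile s ((fun r : 𝓢(Space d, ℂ) => (∂_{diag d} r : 𝓢(Space d, ℂ)))^[i] ρ.ρ) with hh
  have hder : ∀ i t, HasDerivAt (h i) (h (i + 1) t) t := fun i t => by
    simp only [hh, Function.iterate_succ_apply']
    exact hasDerivAt_profile hs _ t
  have hhom : ∀ c : ℝ, 0 < c → ∀ t, h k (c * t) = ((c ^ β : ℝ) : ℂ) * h k t := by
    intro c hc t
    have := eq_of_isHomogeneous_embed ρ P (isHomogeneous_orthantDist hs k)
      (extendsTo_orthantDist hs k) hβ hc (t • diag d)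
    rwa [smul_smul, orthantFunctional_reflect, orthantFunctional_reflect] at this
  have h0 := eq_zero_of_homogeneous_of_decay hder (fun i n => profile_decay hd hs _ n) hhom
  have hlim := tendsto_profile hs ρ.ρ
  have h1 : profile s ρ.ρ = fun _ => 0 := funext h0
  simp only [h1, mul_zero, ρ.integral_eq_one, one_mul] at hlim
  have h2 := tendsto_nhds_unique hlim tendsto_const_nhds
  have h3 : diag d ≠ 0 := fun h => by
    have := congrArg (fun x : Space d => x ⟨0, hd⟩) h
    simp [diag_apply] at this
  exact (Real.rpow_pos_of_pos (norm_pos_iff.2 h3) s).ne' (by exact_mod_cast h2)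

/-! ### Multiples of the oscillating generalized number -/

lemma Gen.pair_const_mul {Ω : TopologicalSpace.Opens (Space d)} (φ : 𝓓(Ω, ℂ)) (a : GenNum)
    (u : Gen d) : Gen.pair φ (Gen.const d a * u) = a * Gen.pair φ u := by
  obtain ⟨u, rfl⟩ := Ideal.Quotient.mk_surjective u
  obtain ⟨a, rfl⟩ := Ideal.Quotient.mk_surjective a
  change Ideal.Quotient.mk numNegligible (pairMod φ (constMod d a * u)) =
    Ideal.Quotient.mk numNegligible (a * pairMod φ u)
  congr 1
  ext ε
  change ∫ x, ((a : Param → ℂ) ε * (u : Param → Space d → ℂ) ε x) * φ x =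
    (a : Param → ℂ) ε * ∫ x, (u : Param → Space d → ℂ) ε x * φ x
  simp only [mul_assoc]
  exact integral_const_mul _ _

lemma Gen.scale_const (c : ℝ) (a : GenNum) : Gen.scale c (Gen.const d a) = Gen.const d a := by
  obtain ⟨a, rfl⟩ := Ideal.Quotient.mk_surjective a
  rfl

lemma Gen.IsWeaklyHomogeneous.const_mul {u : Gen d} {α : ℝ} (hu : u.IsWeaklyHomogeneous α)
    (a : GenNum) : (Gen.const d a * u).IsWeaklyHomogeneous α := by
  intro c hc φ
  rw [map_mul, Gen.scale_const, Gen.pair_const_mul, hu c hc φ, ← mul_smul_comm,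
    Gen.pair_const_mul]

lemma isWeaklyHomogeneous_one : (1 : Gen d).IsWeaklyHomogeneous 0 := by
  intro c hc φ
  rw [map_one, Real.rpow_zero, Complex.ofReal_one, one_smul]

lemma pair_one {Ω : TopologicalSpace.Opens (Space d)} (φ : 𝓓(Ω, ℂ)) :
    Gen.pair φ (1 : Gen d) = algebraMap ℂ GenNum (∫ x, φ x) := by
  change Ideal.Quotient.mk numNegligible (pairMod φ 1) =
    Ideal.Quotient.mk numNegligible (algebraMap ℂ numModerate (∫ x, φ x))
  congr 1
  ext ε
  change ∫ x, 1 * φ x = ∫ x, φ x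
  simp only [one_mul]

lemma tendsto_param_toZero {x : ℕ → Param} (h : Tendsto (fun n => (x n : ℝ)) atTop (𝓝 0)) :
    Tendsto x atTop toZero := tendsto_comap_iff.2 h

/-- Along `ε = 1 / (n + 1)` the net is constantly `z`, along `ε = 2 / (2n + 3)` it is constantly
`0`. Changing the representative adds a net tending to `0` and cannot repair this. -/
lemma not_isAssociated_osc_mul {z : ℂ} (hz : z ≠ 0) (y : ℂ) :
    ¬ (osc * algebraMap ℂ GenNum z).IsAssociated y := by
  rintro ⟨r, hr, hlim⟩
  have h1 : r - (⟨oscNet, oscNet_mem⟩ : numModerate) * algebraMap ℂ numModerate z ∈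
      numNegligible := Ideal.Quotient.eq.1 hr
  obtain ⟨C, hC⟩ := h1 1
  have h2 : Tendsto (fun ε => (r : Param → ℂ) ε - oscNet ε * z) toZero (𝓝 0) := by
    refine squeeze_zero_norm' (a := fun ε : Param => C * (ε : ℝ)) ?_
      (by simpa using tendsto_coe_toZero.const_mul C)
    filter_upwards [hC] with ε hC
    rw [pow_one] at hC
    exact hC
  have h3 : Tendsto (fun ε => oscNet ε * z) toZero (𝓝 y) := by
    simpa using hlim.sub h2
  have hinv : Tendsto (fun n : ℕ => 1 / ((n : ℝ) + 1)) atTop (𝓝 0) :=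
    tendsto_one_div_add_atTop_nhds_zero_nat
  have hy1 : y = z := by
    have hmem : ∀ n : ℕ, 1 / ((n : ℝ) + 1) ∈ Set.Ioc (0 : ℝ) 1 := fun n =>
      ⟨by positivity, by rw [div_le_one (by positivity)]; linarith [n.cast_nonneg (α := ℝ)]⟩
    have h4 := h3.comp (tendsto_param_toZero (x := fun n => ⟨_, hmem n⟩) hinv)
    refine tendsto_nhds_unique h4 (tendsto_const_nhds.congr fun n => ?_)
    have : oscNet ⟨_, hmem n⟩ = 1 := if_pos ⟨n + 1, by push_cast; rfl⟩
    simp only [Function.comp_apply, this, one_mul]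
  have hy0 : y = 0 := by
    have hmem : ∀ n : ℕ, 2 / (2 * (n : ℝ) + 3) ∈ Set.Ioc (0 : ℝ) 1 := fun n =>
      ⟨by positivity, by rw [div_le_one (by positivity)]; linarith [n.cast_nonneg (α := ℝ)]⟩
    have hlim' : Tendsto (fun n : ℕ => 2 / (2 * (n : ℝ) + 3)) atTop (𝓝 0) := by
      refine squeeze_zero (fun n => (hmem n).1.le) (fun n => ?_) hinv
      rw [div_le_div_iff₀ (by positivity) (by positivity)]
      linarith
    have h4 := h3.comp (tendsto_param_toZero (x := fun n => ⟨_, hmem n⟩) hlim')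
    refine tendsto_nhds_unique h4 (tendsto_const_nhds.congr fun n => ?_)
    have : oscNet ⟨_, hmem n⟩ = 0 := by
      refine if_neg ?_
      rintro ⟨m, hm⟩
      -- The condition in `oscNet` admits `n = 0`, where `1 / 0 = 0`; positivity of `ε` rules it
      -- out.
      have hm0 : (m : ℝ) ≠ 0 := by
        intro h
        have h0 := (hmem n).1
        rw [show (2 / (2 * (n : ℝ) + 3)) = 1 / (m : ℝ) from hm, h] at h0
        simp at h0
      have h5 : 2 / (2 * (n : ℝ) + 3) = 1 / (m : ℝ) := hm
      rw [div_eq_div_iff (by positivity) hm0] at h5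
      -- Impossible by parity.
      have h6 : 2 * m = 2 * n + 3 := by
        have : (2 * (m : ℝ)) = 2 * n + 3 := by linarith
        exact_mod_cast this
      omega
    simp only [Function.comp_apply, this, zero_mul]
  exact hz (hy1 ▸ hy0)

/-- Serves to show that a distribution with non-homogeneous embedding is not zero. -/
lemma embed_zero_isHomogeneous (ρ : Mollifier d) (P : CutoffSystem d) (β : ℝ) :
    (embed ρ P 0).IsHomogeneous β := by
  have h : embed ρ P 0 = 0 := by
    have : (⟨embedNet ρ P 0, embedNet_mem_moderate ρ P 0⟩ : moderate d) = 0 := by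
      ext ε x
      simp [embedNet, cutConv]
    rw [embed, this, map_zero]
  intro c _
  rw [h, map_zero, smul_zero]

lemma exists_integral_ne_zero (d : ℕ) :
    ∃ φ : 𝓓((⊤ : TopologicalSpace.Opens (Space d)), ℂ), ∫ x, φ x ≠ 0 := by
  let f : ContDiffBump (0 : Space d) := default
  refine ⟨⟨fun x => (f x : ℂ), Complex.ofRealCLM.contDiff.comp f.contDiff,
    f.hasCompactSupport.comp_left Complex.ofReal_zero, fun _ _ => trivial⟩, ?_⟩
  change ∫ x, (f x : ℂ) ≠ 0
  rw [integral_complex_ofReal, Complex.ofReal_ne_zero]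
  exact f.integral_pos.ne'

lemma orthantDist_zero_zero : orthantDist d 0 0 = heavisideTensor d := by
  change regular _ = regular _
  congr 1
  funext x
  simp [orthantPower]

end Colombeau

end

theorem mainTheorem8 (d : ℕ) (hd : 1 ≤ d) (ρ : Colombeau.Mollifier d)
    (P : Colombeau.CutoffSystem d) :
    (∀ α : ℝ, ∃ w : Colombeau.Dist d, w.IsHomogeneous α ∧
        (Colombeau.embed ρ P w).IsWeaklyHomogeneous α ∧
        ∀ β : ℝ, ¬ (Colombeau.embed ρ P w).IsHomogeneous β) ∧
    ((Colombeau.heavisideTensor d).IsHomogeneous 0 ∧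
        (Colombeau.embed ρ P (Colombeau.heavisideTensor d)).IsWeaklyHomogeneous 0 ∧
        ∀ β : ℝ, ¬ (Colombeau.embed ρ P (Colombeau.heavisideTensor d)).IsHomogeneous β) ∧
    (∀ α : ℝ, ∃ u : Colombeau.Gen d, u.IsWeaklyHomogeneous α ∧
        ¬ ∃ w : Colombeau.Dist d, u.IsAssociated w) ∧
    ((Colombeau.Gen.const d Colombeau.osc).IsWeaklyHomogeneous 0 ∧
        ¬ ∃ w : Colombeau.Dist d, (Colombeau.Gen.const d Colombeau.osc).IsAssociated w) := by
  open Colombeau in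
  -- Enough derivatives are taken that the undifferentiated density has exponent `s ≥ 0`, hence is
  -- locally bounded.
  have hα : ∀ α : ℝ, ∃ (s : ℝ) (k : ℕ), 0 ≤ s ∧ s - k = α := fun α =>
    ⟨α + ⌈-α⌉₊, ⌈-α⌉₊, by linarith [Nat.le_ceil (-α)], by ring⟩
  have key : ∀ (s : ℝ) (k : ℕ), 0 ≤ s → (orthantDist d s k).IsHomogeneous (s - k) ∧
      (embed ρ P (orthantDist d s k)).IsWeaklyHomogeneous (s - k) ∧
      ∀ β : ℝ, ¬ (embed ρ P (orthantDist d s k)).IsHomogeneous β := fun s k hs =>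
    ⟨isHomogeneous_orthantDist hs k,
      (commutesWithIntegral_orthantDist hs k).isWeaklyHomogeneous_embed ρ P
        (isHomogeneous_orthantDist hs k),
      not_isHomogeneous_embed_orthantDist hd ρ P hs k⟩
  refine ⟨fun α => ?_, ?_, fun α => ?_, ?_, ?_⟩
  · obtain ⟨s, k, hs, rfl⟩ := hα α
    exact ⟨_, key s k hs⟩
  · have := key 0 0 le_rfl
    rwa [Nat.cast_zero, sub_zero, orthantDist_zero_zero] at this
  · obtain ⟨s, k, hs, rfl⟩ := hα α
    obtain ⟨-, h2, h3⟩ := key s k hs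
    refine ⟨Gen.const d osc * embed ρ P (orthantDist d s k), h2.const_mul osc, ?_⟩
    rintro ⟨w, hw⟩
    refine h3 0 ?_
    -- If `osc * ι(w)` had an associated distribution, every `osc * w φ` would converge, which
    -- forces `w φ = 0`; then `ι(w) = 0` would be homogeneous.
    have h0 : orthantDist d s k = 0 := by
      ext φ
      by_contra hne
      refine not_isAssociated_osc_mul hne (w φ) ?_
      rw [← (commutesWithIntegral_orthantDist hs k).pair_embed ρ P φ, ← Gen.pair_const_mul]
      exact hw φ
    rw [h0]
    exact embed_zero_isHomogeneous ρ P 0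
  · simpa using (isWeaklyHomogeneous_one (d := d)).const_mul osc
  · rintro ⟨w, hw⟩
    obtain ⟨φ, hφ⟩ := exists_integral_ne_zero d
    refine not_isAssociated_osc_mul hφ (w φ) ?_
    rw [← pair_one, ← Gen.pair_const_mul, mul_one]
    exact hw φ
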